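/- **Setting.** Let $\mathcal X,\mathcal A$ be finite non-empty sets (states, actions), $\mathcal K=\mathcal X\times\mathcal A$, $P(\cdot\mid x,a)$ a probability on $\mathcal X$ for each $(x,a)\in\mathcal K$, and $c:\mathcal K\to\mathbb R$ a cost function; $\mathcal L(S)$ is the set of real functions on a finite set $S$, with the sup norm. A *monetary risk measure* on a finite probability space $(\Omega,p)$ is a map $\rho:\mathcal L(\Omega)\to\mathbb R$ with $\rho(v)\le\rho(w)$ whenever $v\le w$ $p$-a.s., $\rho(v+\lambda)=\rho(v)+\lambda$ for $\lambda\in\mathbb R$, and $\rho(0)=0$; it is *coherent* if moreover it is convex and $\rho(\lambda v)=\lambda\rho(v)$ for $\lambda\ge0$. A *risk map* $\mathcal R$ assigns to each $(x,a)$ a monetary risk measure $\mathcal R_{x,a}$ on $(\mathcal X,P(\cdot\mid x,a))$. **Assumptions.** Strong ergodicity: for every stationary (randomized) policy $\pi$ the chain with transition matrix $\sum_a\pi(a\mid x)P(y\mid x,a)$ is irreducible, and there is $\bar x\in\mathcal X$ with $P(\bar x\mid x,a)>0$ for all $(x,a)$. With $\mathbb E_{x,a}$ the expectation under $P(\cdot\mid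 x,a)$ and $F_v^{-1}(\beta)=\inf\{m:F_v(m)\ge\beta\}$ the quantile function of $v$ under $P(\cdot\mid x,a)$, let $\mathcal R$ be one of the following: 1. (UBSR) $\mathcal R_{x,a}(v)=\inf\{m\in\mathbb R:\mathbb E_{x,a}[\ell(v-m)]\le0\}$, with $\ell:\mathbb R\to\mathbb R$ continuous, non-decreasing, convex, $\ell(0)=0$; 2. (OCE) $\mathcal R_{x,a}(v)=\inf_{\xi\in\mathbb R}\{\xi+\mathbb E_{x,a}[\ell(v-\xi)]\}$, with $\ell$ non-decreasing, convex, $\ell(0)=0$, $1\in\partial\ell(0)$; 3. (spectral) $\mathcal R_{x,a}(v)=\int_0^1\phi(\beta)F_v^{-1}(\beta)\,d\beta$, with $\phi:[0,1]\to[0,\infty)$, $\int_0^1\phi=1$ and $0<\epsilon_2\le\phi\le L_2<\infty$ on $[0,1]$; where in cases 1 and 2 $\ell$ is strictly increasing and there are $\epsilon_1,L_1>0$ with $\epsilon_1\le\frac{\ell(x)-\ell(y)}{x-y}\le L_1$ for all $x\ne y$. **Conclusions.** $\mathcal R$ is a risk map, and: * (Doeblin condition) there are a coherent risk measure $\nu$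 on $\mathcal L(\mathcal X)$ and $\bar\alpha\in(0,1)$ such that $\mathcal R_{x,a}(v)-\bar\alpha\nu(v)-\mathcal R_{x,a}(v')+\bar\alpha\nu(v')\ge0$ for all $v\ge v'$ in $\mathcal L(\mathcal X)$ and all $(x,a)$; * (asymptotic coherence) there is a risk map $\mathcal R^\infty$ such that for every $(x,a)$, $\frac1s\mathcal R_{x,a}(sv)\to\mathcal R^\infty_{x,a}(v)$ as $s\to\infty$, for every $v\in\mathcal L(\mathcal X)$ and uniformly on compact subsets of $\mathcal L(\mathcal X)$; * (Wasserstein-Lipschitz continuity) there is $\mathfrak L>0$ with $|\mathcal R_{x,a}(v)-\mathcal R_{x,a}(w)|\le\mathfrak L\,d_W(\mu_v,\mu_w)$ for all $v,w$ and $(x,a)$, where $\mu_v,\mu_w$ are the laws of $v,w$ under $P(\cdot\mid x,a)$ and $d_W$ is the 1-Wasserstein distance. Consequently the Q-learning convergence theorem applies. Namely, let $\mathcal H(q)(x,a)=\mathcal R_{x,a}\bigl(c(x,a)+\min_{a'}q(\cdot,a')\bigr)$ and let $f:\mathcal L(\mathcal K)\to\mathbb R$ be Lipschitz with $f(0)=0$,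 $f(q+\lambda)=f(q)+\lambda$ and $f(\lambda q)=\lambda f(q)$ for all $\lambda\in\mathbb R$. Then there is $Q^*\in\mathcal L(\mathcal K)$ such that $g^*=f(Q^*)$ and $h^*(x)=\min_aQ^*(x,a)$ solve the average risk optimality equation $$g^*+h^*(x)=\min_{a}\{c(x,a)+\mathcal R_{x,a}(h^*)\}\qquad(x\in\mathcal X),$$ and every stationary deterministic policy $d:\mathcal X\to\mathcal A$ that is greedy for $Q^*$ (that is, $d(x)\in\arg\min_aQ^*(x,a)$ for all $x$) has average risk $g^*$ from every initial state and is optimal: it minimizes, from every initial state $X_0$ and over all randomized Markov policies $(\pi_0,\pi_1,\dots)$, the average risk $\limsup_{T\to\infty}\frac1TJ_T$, where $J_T=c^{\pi_0}(X_0)+\mathcal R^{\pi_0}_{X_0}\bigl(c^{\pi_1}(X_1)+\dots+\mathcal R^{\pi_{T-1}}_{X_{T-1}}(c^{\pi_T}(X_T))\cdots\bigr)$, $c^\pi(x)=\sum_a\pi(a\mid x)c(x,a)$ and $\mathcal R^\pi_x(v)=\sum_a\pi(a\mid x)\mathcal R_{x,a}(v)$. Moreover, let $\hat{\mathcal H}$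 be any estimator of $\mathcal H$ with $\mathbb E[\hat{\mathcal H}(q)]=\mathcal H(q)$ and $\operatorname{Var}[\hat{\mathcal H}(q)(x,a)]\le C(1+\|q\|_\infty^2)$ for some $C>0$, all $q\in\mathcal L(\mathcal K)$ and all $(x,a)$; let $\gamma(n)\ge0$ with $\sum_n\gamma(n)=\infty$ and $\sum_n\gamma(n)^2<\infty$; let $Q_0\in\mathcal L(\mathcal K)$ be arbitrary, and $$Q_{n+1}=Q_n+\gamma(n)\bigl(\hat{\mathcal H}(Q_n)-f(Q_n)-Q_n\bigr),$$ where the estimator is computed at each step from fresh samples (i.i.d. over the steps). Then almost surely $Q_n\to Q^*$, and for all sufficiently large $n$ every greedy policy for $Q_n$ is greedy for $Q^*$, hence an optimal stationary deterministic policy (so the greedy policies converge to the greedy policy of $Q^*$ whenever the latter is unique). -/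

import Mathlib

open Filter Topology MeasureTheory ProbabilityTheory
open scoped ENNReal

noncomputable section

namespace RiskMDP

/-! ### Risk measures on a finite probability space `(Ω, p)` -/

section RiskMeasures

variable {Ω : Type*} [Fintype Ω]

/-- Monetary risk measure on the finite probability space `(Ω, p)`. -/
structure IsMonetary (p : stdSimplex ℝ Ω) (ρ : (Ω → ℝ) → ℝ) : Prop where
  mono : ∀ v w : Ω → ℝ, (∀ ω, 0 < p.1 ω → v ω ≤ w ω) → ρ v ≤ ρ w
  translation : ∀ (v : Ω → ℝ) (r : ℝ), ρ (fun ω => v ω + r) = ρ v + r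
  normalized : ρ 0 = 0

/-- Coherent risk measure on the finite probability space `(Ω, p)`. -/
structure IsCoherent (p : stdSimplex ℝ Ω) (ρ : (Ω → ℝ) → ℝ) : Prop extends IsMonetary p ρ where
  convex : ∀ (t : ℝ) (v w : Ω → ℝ), 0 ≤ t → t ≤ 1 →
    ρ (t • v + (1 - t) • w) ≤ t * ρ v + (1 - t) * ρ w
  posHom : ∀ (r : ℝ) (v : Ω → ℝ), 0 ≤ r → ρ (r • v) = r * ρ v

/-- Expectation `E[v]` under `p`. -/
def expect (p : stdSimplex ℝ Ω) (v : Ω → ℝ) : ℝ := ∑ ω, p.1 ω * v ω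

/-- Utility-based shortfall risk with loss function `l`. -/
def UBSR (l : ℝ → ℝ) (p : stdSimplex ℝ Ω) (v : Ω → ℝ) : ℝ :=
  sInf {m : ℝ | expect p (fun ω => l (v ω - m)) ≤ 0}

/-- Optimized certainty equivalent with loss function `l`. -/
def OCE (l : ℝ → ℝ) (p : stdSimplex ℝ Ω) (v : Ω → ℝ) : ℝ :=
  ⨅ ξ : ℝ, (ξ + expect p (fun ω => l (v ω - ξ)))

/-- Cumulative distribution function of `v` under `p`. -/
def cdfOf (p : stdSimplex ℝ Ω) (v : Ω → ℝ) (m : ℝ) : ℝ := ∑ ω with v ω ≤ m, p.1 ω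

/-- Quantile function of `v` under `p`. Its value at `β = 0` plays no role. -/
def quantile (p : stdSimplex ℝ Ω) (v : Ω → ℝ) (β : ℝ) : ℝ := sInf {m : ℝ | β ≤ cdfOf p v m}

/-- Spectral risk measure with spectrum `φ` (only the values of `φ` on `[0,1]` matter). -/
def spectralRisk (φ : ℝ → ℝ) (p : stdSimplex ℝ Ω) (v : Ω → ℝ) : ℝ :=
  ∫ β in (0 : ℝ)..1, φ β * quantile p v β

/-- The distribution of `v` under `p`, a measure on `ℝ`. -/
def lawOf (p : stdSimplex ℝ Ω) (v : Ω → ℝ) : Measure ℝ :=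
  ∑ ω, ENNReal.ofReal (p.1 ω) • Measure.dirac (v ω)

end RiskMeasures

/-- Loss functions admitted in the definition of UBSR. -/
structure IsUBSRLoss (l : ℝ → ℝ) : Prop where
  continuous : Continuous l
  monotone : Monotone l
  convex : ConvexOn ℝ Set.univ l
  zero : l 0 = 0

/-- Loss functions admitted in the definition of OCE; `subgradient` says `1 ∈ ∂l(0)`. -/
structure IsOCELoss (l : ℝ → ℝ) : Prop where
  monotone : Monotone l
  convex : ConvexOn ℝ Set.univ l
  zero : l 0 = 0
  subgradient : ∀ y : ℝ, l 0 + 1 * (y - 0) ≤ l y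

/-- Bounded slopes. -/
def BoundedSlope (l : ℝ → ℝ) : Prop :=
  StrictMono l ∧ ∃ ε L : ℝ, 0 < ε ∧ 0 < L ∧
    ∀ x y : ℝ, x ≠ y → ε ≤ (l x - l y) / (x - y) ∧ (l x - l y) / (x - y) ≤ L

/-- Risk spectra: nonnegative functions on `[0,1]` of integral one. (The integral being nonzero,
such a function is integrable on `[0,1]`.) -/
structure IsSpectrum (φ : ℝ → ℝ) : Prop where
  nonneg : ∀ β ∈ Set.Icc (0 : ℝ) 1, 0 ≤ φ β
  integral_eq_one : ∫ β in (0 : ℝ)..1, φ β = 1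

/-- 1-Wasserstein distance of two measures on `ℝ`: infimum of the transport cost over all
couplings. -/
def wasserstein (μ ν : Measure ℝ) : ℝ≥0∞ :=
  ⨅ (ψ : Measure (ℝ × ℝ)) (_ : ψ.map Prod.fst = μ ∧ ψ.map Prod.snd = ν),
    ∫⁻ z, ENNReal.ofReal |z.1 - z.2| ∂ψ

/-! ### Finite Markov decision processes and risk maps -/

/-- A finite MDP: transition kernel and cost function. -/
structure MDP (X A : Type*) [Fintype X] where
  P : X → A → stdSimplex ℝ X
  c : X → A → ℝ

section Model

variable {X A : Type*} [Fintype X] [Fintype A]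

/-- The transition matrix of the chain under the stationary policy `π`. -/
def MDP.chain (M : MDP X A) (π : X → stdSimplex ℝ A) : Matrix X X ℝ :=
  Matrix.of fun x y => ∑ a, (π x).1 a * (M.P x a).1 y

/-- Strong ergodicity. -/
def MDP.StronglyErgodic (M : MDP X A) : Prop :=
  (∀ π : X → stdSimplex ℝ A, (M.chain π).IsIrreducible) ∧
    ∃ xbar : X, ∀ x a, 0 < (M.P x a).1 xbar

/-- A risk map: `R x a` is a monetary risk measure on `(X, P(·|x,a))`. -/
def IsRiskMap (M : MDP X A) (R : X → A → (X → ℝ) → ℝ) : Prop :=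
  ∀ x a, IsMonetary (M.P x a) (R x a)

/-- Doeblin type condition. -/
def Doeblin (R : X → A → (X → ℝ) → ℝ) : Prop :=
  ∃ (p : stdSimplex ℝ X) (ν : (X → ℝ) → ℝ), IsCoherent p ν ∧
    ∃ α : ℝ, 0 < α ∧ α < 1 ∧ ∀ v v' : X → ℝ, v' ≤ v → ∀ x a,
      0 ≤ R x a v - α * ν v - R x a v' + α * ν v'

/-- Asymptotic coherence: rescaled risk maps converge to a risk map, pointwise and uniformly on
compact sets. -/
def AsymptoticallyCoherent (M : MDP X A) (R : X → A → (X → ℝ) → ℝ) : Prop :=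
  ∃ Rinf : X → A → (X → ℝ) → ℝ, IsRiskMap M Rinf ∧ ∀ x a,
    (∀ v : X → ℝ, Tendsto (fun s : ℝ => 1 / s * R x a (s • v)) atTop (𝓝 (Rinf x a v))) ∧
    ∀ C : Set (X → ℝ), IsCompact C →
      TendstoUniformlyOn (fun (s : ℝ) v => 1 / s * R x a (s • v)) (Rinf x a) atTop C

/-- Lipschitz continuity with respect to the 1-Wasserstein distance. -/
def WassersteinLipschitz (M : MDP X A) (R : X → A → (X → ℝ) → ℝ) : Prop :=
  ∃ L : ℝ, 0 < L ∧ ∀ (v w : X → ℝ) (x : X) (a : A),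
    ENNReal.ofReal |R x a v - R x a w| ≤
      ENNReal.ofReal L * wasserstein (lawOf (M.P x a) v) (lawOf (M.P x a) w)

/-! ### The average risk criterion -/

/-- `c^π(x)`. -/
def costUnder (M : MDP X A) (π : X → stdSimplex ℝ A) (x : X) : ℝ :=
  ∑ a, (π x).1 a * M.c x a

/-- `R^π(v|x)`. -/
def riskUnder (R : X → A → (X → ℝ) → ℝ) (π : X → stdSimplex ℝ A) (v : X → ℝ) (x : X) : ℝ :=
  ∑ a, (π x).1 a * R x a v

/-- The nested `T`-stage risk
`c^{π₀}(x) + R_x^{π₀}(c^{π₁}(X₁) + ⋯ + R_{X_{T-1}}^{π_{T-1}}(c^{π_T}(X_T)) ⋯ )` of the Markov policy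
`π = (π₀, π₁, …)` from the initial state `x`. -/
def totalRisk (M : MDP X A) (R : X → A → (X → ℝ) → ℝ) :
    ℕ → (ℕ → X → stdSimplex ℝ A) → X → ℝ
  | 0, π, x => costUnder M (π 0) x
  | T + 1, π, x =>
      costUnder M (π 0) x + riskUnder R (π 0) (totalRisk M R T (fun t => π (t + 1))) x

/-- The long-run average risk of the Markov policy `π` from the initial state `x`. -/
def averageRisk (M : MDP X A) (R : X → A → (X → ℝ) → ℝ) (π : ℕ → X → stdSimplex ℝ A) (x : X) : ℝ :=
  limsup (fun T : ℕ => 1 / (T : ℝ) * totalRisk M R T π x) atTop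

open Classical in
/-- The stationary deterministic Markov policy that takes action `d x` in state `x`. -/
def stationary (d : X → A) : ℕ → X → stdSimplex ℝ A :=
  fun _ x => ⟨Pi.single (d x) 1, single_mem_stdSimplex ℝ (d x)⟩

/-- The stationary deterministic policy `d` is optimal, for every initial state, among all
(randomized, time-dependent) Markov policies. -/
def IsOptimal (M : MDP X A) (R : X → A → (X → ℝ) → ℝ) (d : X → A) : Prop :=
  ∀ (x₀ : X) (π : ℕ → X → stdSimplex ℝ A),
    averageRisk M R (stationary d) x₀ ≤ averageRisk M R π x₀

/-- The average risk optimality equation. -/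
def SolvesAROE (M : MDP X A) (R : X → A → (X → ℝ) → ℝ) (g : ℝ) (h : X → ℝ) : Prop :=
  ∀ x, g + h x = ⨅ a, (M.c x a + R x a h)

/-! ### Risk-aware RVI Q-learning -/

/-- `min_a q(·, a)`. -/
def minAction (q : X × A → ℝ) (x : X) : ℝ := ⨅ a, q (x, a)

/-- `d` selects in each state an action minimizing `q`. -/
def IsGreedy (q : X × A → ℝ) (d : X → A) : Prop := ∀ x a, q (x, d x) ≤ q (x, a)

/-- The risk-aware Bellman optimality operator for Q-factors. -/
def bellman (M : MDP X A) (R : X → A → (X → ℝ) → ℝ) (q : X × A → ℝ) : X × A → ℝ :=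
  fun k => R k.1 k.2 (fun y => M.c k.1 k.2 + minAction q y)

/-- The conditions on the reference function `f`: normalization, translation invariance,
Lipschitz continuity (for the sup norm) and homogeneity. -/
structure IsReference (f : (X × A → ℝ) → ℝ) : Prop where
  zero : f 0 = 0
  translation : ∀ (q : X × A → ℝ) (r : ℝ), f (fun k => q k + r) = f q + r
  lipschitz : ∃ L : ℝ, 0 ≤ L ∧ ∀ p q : X × A → ℝ, |f p - f q| ≤ L * ‖p - q‖
  homogeneous : ∀ (r : ℝ) (q : X × A → ℝ), f (r • q) = r * f q

/-- The Robbins–Monro condition on the step sizes. -/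
structure RobbinsMonro (γ : ℕ → ℝ) : Prop where
  nonneg : ∀ n, 0 ≤ γ n
  sum_eq_top : Tendsto (fun n => ∑ i ∈ Finset.range n, γ i) atTop atTop
  sum_sq : Summable fun n => γ n ^ 2

/-- `Hhat q e` is the estimate of `H q` computed from the random sample `e` of law `η`: it is
unbiased, with variance at most `C (1 + ‖q‖²)`. -/
structure IsUnbiasedEstimator {E : Type*} [MeasurableSpace E] (η : Measure E)
    (H : (X × A → ℝ) → X × A → ℝ) (Hhat : (X × A → ℝ) → E → X × A → ℝ) : Prop where
  measurable : Measurable (Function.uncurry Hhat)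
  memLp : ∀ q k, MemLp (fun e => Hhat q e k) 2 η
  mean : ∀ q k, ∫ e, Hhat q e k ∂η = H q k
  var : ∃ C : ℝ, 0 < C ∧ ∀ q k, variance (fun e => Hhat q e k) η ≤ C * (1 + ‖q‖ ^ 2)

/-- The Q-learning iterates with step sizes `γ`, initial value `Q₀` and samples `ξ 0, ξ 1, …`. -/
def qIter {E : Type*} (f : (X × A → ℝ) → ℝ) (Hhat : (X × A → ℝ) → E → X × A → ℝ) (γ : ℕ → ℝ)
    (Q₀ : X × A → ℝ) (ξ : ℕ → E) : ℕ → X × A → ℝ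
  | 0 => Q₀
  | n + 1 => fun k =>
      qIter f Hhat γ Q₀ ξ n k +
        γ n * (Hhat (qIter f Hhat γ Q₀ ξ n) (ξ n) k - f (qIter f Hhat γ Q₀ ξ n)
          - qIter f Hhat γ Q₀ ξ n k)

end Model

end RiskMDP

end

/-! All three families share one property, `HasSlopes`: if `w ≤ v`, then `ρ v - ρ w` lies between `δ
E[v - w]` and `L E[v - w]`. Keeping only the atom at the common state `x̄` in the lower bound gives
`R v - R w ≥ α (v x̄ - w x̄)` (`Minorized`), which is the Doeblin condition with `ν` the evaluation
at `x̄`. The upper bound gives Wasserstein continuity: the risk measures depend only on laws, so `v`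
and `w` may be replaced by the two coordinates of a coupling. The limits of `ρ (s v) / s` exist by
convexity in the first two cases and by positive homogeneity in the third.

The minorization makes the Bellman operator shrink the oscillation `max - min` by the factor `1 -
α`. Subtracting `f q` makes it invariant under adding constants to `q`, so its value at a fixed
point `k₀` is also controlled by the oscillation. Hence it is a contraction in the norm `|e k₀| + c
(max e - min e)` for large `c` (`relBellman_contraction`). Its fixed point is `Q*`; the optimality
equation is the fixed point equation after minimizing over actions, and optimality of greedy
policies follows by induction on the horizon.

For the learning iterates, the contraction norm `N` is not smooth, so `N² / 2` is replaced by its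
Moreau envelope `V`: close to `N² / 2`, with a quadratic upper bound, and decreasing in the
direction of the mean step (`exists_lyapunov`). Thus `V (Q_n - Q*)` has conditional drift at most
`-c γ V + D γ² (1 + V)`, and a supermartingale argument (`tendsto_zero_of_drift`) sends it to zero.
As there are finitely many actions, strict inequalities between values of `Q*` eventually hold for
`Q_n`. -/

namespace RiskMDP

/-! ### A smooth Lyapunov function -/

section Lyapunov

variable {K : Type*} [Fintype K]

/-- The function minimized in the definition of the Moreau envelope of `N² / 2`. -/
noncomputable def moreauObj (N : Seminorm ℝ (K → ℝ)) (θ : ℝ) (e u : K → ℝ) : ℝ :=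
  N u ^ 2 / 2 + (∑ k, (e k - u k) ^ 2) / (2 * θ)

/-- The Moreau envelope of `N² / 2`. -/
noncomputable def moreauEnv (N : Seminorm ℝ (K → ℝ)) (θ : ℝ) (e : K → ℝ) : ℝ :=
  ⨅ u, moreauObj N θ e u

lemma norm_sq_le_sum_sq (d : K → ℝ) : ‖d‖ ^ 2 ≤ ∑ k, d k ^ 2 := by
  have h0 : 0 ≤ ∑ k, d k ^ 2 := Finset.sum_nonneg fun k _ => sq_nonneg _
  have : ‖d‖ ≤ √(∑ k, d k ^ 2) := by
    refine (pi_norm_le_iff_of_nonneg (Real.sqrt_nonneg _)).2 fun k => ?_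
    refine Real.le_sqrt_of_sq_le ?_
    rw [Real.norm_eq_abs, sq_abs]
    exact Finset.single_le_sum (f := fun k => d k ^ 2) (fun k _ => sq_nonneg _) (Finset.mem_univ k)
  calc ‖d‖ ^ 2 ≤ √(∑ k, d k ^ 2) ^ 2 := by gcongr
    _ = _ := Real.sq_sqrt h0

lemma seminorm_continuous_of_le {N : Seminorm ℝ (K → ℝ)} {C : ℝ} (hC : ∀ e, N e ≤ C * ‖e‖) :
    Continuous N :=
  Seminorm.continuous_of_le (p := N) (q := C.toNNReal • normSeminorm ℝ (K → ℝ))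
    (by
      have : Continuous fun e : K → ℝ => (C.toNNReal : ℝ) * ‖e‖ := by fun_prop
      exact this)
    (fun e => by
      refine (hC e).trans ?_
      change C * ‖e‖ ≤ (C.toNNReal : ℝ) * ‖e‖
      gcongr
      exact Real.le_coe_toNNReal C)

lemma moreauObj_nonneg (N : Seminorm ℝ (K → ℝ)) {θ : ℝ} (hθ : 0 < θ) (e u : K → ℝ) :
    0 ≤ moreauObj N θ e u := by
  have : 0 ≤ ∑ k, (e k - u k) ^ 2 := Finset.sum_nonneg fun k _ => sq_nonneg _
  unfold moreauObj
  positivity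

lemma bddBelow_moreauObj (N : Seminorm ℝ (K → ℝ)) {θ : ℝ} (hθ : 0 < θ) (e : K → ℝ) :
    BddBelow (Set.range (moreauObj N θ e)) :=
  ⟨0, by rintro _ ⟨u, rfl⟩; exact moreauObj_nonneg N hθ e u⟩

lemma moreauEnv_le (N : Seminorm ℝ (K → ℝ)) {θ : ℝ} (hθ : 0 < θ) (e u : K → ℝ) :
    moreauEnv N θ e ≤ moreauObj N θ e u :=
  ciInf_le (bddBelow_moreauObj N hθ e) u

lemma moreauEnv_nonneg (N : Seminorm ℝ (K → ℝ)) {θ : ℝ} (hθ : 0 < θ) (e : K → ℝ) :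
    0 ≤ moreauEnv N θ e :=
  le_ciInf fun u => moreauObj_nonneg N hθ e u

/-- The quadratic term makes the continuous objective coercive. -/
lemma exists_moreauEnv_eq {N : Seminorm ℝ (K → ℝ)} (hN : Continuous N) {θ : ℝ} (hθ : 0 < θ)
    (e : K → ℝ) : ∃ u, moreauEnv N θ e = moreauObj N θ e u := by
  have hc : Continuous (moreauObj N θ e) := by unfold moreauObj; fun_prop
  have ht : Tendsto (moreauObj N θ e) (cocompact (K → ℝ)) atTop := by
    have h1 : Tendsto (fun u : K → ℝ => (‖u‖ - ‖e‖) ^ 2 / (2 * θ)) (cocompact (K → ℝ)) atTop := by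
      refine Tendsto.atTop_div_const (by positivity) ?_
      refine (tendsto_pow_atTop two_ne_zero).comp ?_
      exact tendsto_atTop_add_const_right _ _ (tendsto_norm_cocompact_atTop)
    refine tendsto_atTop_mono (fun u => ?_) h1
    have h2 : (‖u‖ - ‖e‖) ^ 2 ≤ ∑ k, (e k - u k) ^ 2 := by
      refine le_trans ?_ (norm_sq_le_sum_sq (e - u))
      rw [norm_sub_rev, ← sq_abs (‖u‖ - ‖e‖)]
      gcongr
      exact abs_norm_sub_norm_le u e
    unfold moreauObj
    have : 0 ≤ N u ^ 2 / 2 := by positivity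
    have : (‖u‖ - ‖e‖) ^ 2 / (2 * θ) ≤ (∑ k, (e k - u k) ^ 2) / (2 * θ) := by gcongr
    linarith
  obtain ⟨u, hu⟩ := hc.exists_forall_le ht
  exact ⟨u, le_antisymm (moreauEnv_le N hθ e u) (le_ciInf hu)⟩

lemma measurable_moreauEnv {N : Seminorm ℝ (K → ℝ)} {θ : ℝ} (hθ : 0 < θ) :
    Measurable (moreauEnv N θ) := by
  refine UpperSemicontinuous.measurable ?_
  refine upperSemicontinuous_ciInf (fun e => bddBelow_moreauObj N hθ e) fun u => ?_
  have : Continuous fun e => moreauObj N θ e u := by unfold moreauObj; fun_prop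
  exact this.upperSemicontinuous

/-- Taking `u` to be the minimizer at `e` and keeping it as a competitor at `e + d`, this exact
expansion becomes the quadratic upper bound for the envelope, with gradient `(e - u) / θ`. -/
lemma moreauObj_add (N : Seminorm ℝ (K → ℝ)) {θ : ℝ} (hθ : 0 < θ) (e d u : K → ℝ) :
    moreauObj N θ (e + d) u = moreauObj N θ e u + ∑ k, (e k - u k) / θ * d k +
      (∑ k, d k ^ 2) / (2 * θ) := by
  have h : ∑ k, ((e + d) k - u k) ^ 2 =
      ∑ k, (e k - u k) ^ 2 + 2 * θ * ∑ k, (e k - u k) / θ * d k + ∑ k, d k ^ 2 := by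
    rw [Finset.mul_sum, ← Finset.sum_add_distrib, ← Finset.sum_add_distrib]
    refine Finset.sum_congr rfl fun k _ => ?_
    simp only [Pi.add_apply]
    field_simp
    ring
  unfold moreauObj
  rw [h]
  field_simp
  ring

/-- First order optimality of the minimizer in the Moreau envelope. -/
lemma inner_le_of_moreauEnv_eq {N : Seminorm ℝ (K → ℝ)} {θ : ℝ} (hθ : 0 < θ)
    {e u : K → ℝ} (hu : moreauEnv N θ e = moreauObj N θ e u) (z : K → ℝ) :
    ∑ k, (e k - u k) / θ * (z k - e k) ≤ N z ^ 2 / 2 - moreauEnv N θ e := by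
  set a := N u ^ 2 / 2
  set b := N z ^ 2 / 2
  set S := ∑ k, (e k - u k) / θ * (z k - u k) with hS
  set D := (∑ k, (z k - u k) ^ 2) / (2 * θ) with hD
  have hD0 : 0 ≤ D := div_nonneg (Finset.sum_nonneg fun k _ => sq_nonneg _) (by positivity)
  -- The minimizer `u` is compared with the point `u + t (z - u)`; dividing by `t` and letting `t →
  -- 0` gives the variational inequality.
  have key : ∀ t : ℝ, 0 < t → t ≤ 1 → S ≤ b - a + t * D := by
    intro t ht ht1
    have h1 := (hu.symm.le).trans (moreauEnv_le N hθ e (u + t • (z - u)))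
    have hconv : N (u + t • (z - u)) ^ 2 / 2 ≤ (1 - t) * a + t * b := by
      have h2 : N (u + t • (z - u)) ≤ (1 - t) * N u + t * N z := by
        have : u + t • (z - u) = (1 - t) • u + t • z := by
          ext k; simp; ring
        rw [this]
        refine (map_add_le_add N _ _).trans ?_
        rw [map_smul_eq_mul, map_smul_eq_mul, Real.norm_of_nonneg ht.le,
          Real.norm_of_nonneg (by linarith : (0 : ℝ) ≤ 1 - t)]
      have h3 : N (u + t • (z - u)) ^ 2 ≤ ((1 - t) * N u + t * N z) ^ 2 := by
        gcongr
      have h4 : ((1 - t) * N u + t * N z) ^ 2 ≤ (1 - t) * N u ^ 2 + t * N z ^ 2 := by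
        have := mul_nonneg (mul_nonneg ht.le (by linarith : (0 : ℝ) ≤ 1 - t))
          (sq_nonneg (N u - N z))
        nlinarith
      simp only [a, b]
      linarith
    have hquad : (∑ k, (e k - (u + t • (z - u)) k) ^ 2) / (2 * θ) =
        (∑ k, (e k - u k) ^ 2) / (2 * θ) - t * S + t ^ 2 * D := by
      have : ∑ k, (e k - (u + t • (z - u)) k) ^ 2 =
          ∑ k, (e k - u k) ^ 2 - 2 * θ * t * S + t ^ 2 * ∑ k, (z k - u k) ^ 2 := by
        rw [hS, Finset.mul_sum, Finset.mul_sum, ← Finset.sum_sub_distrib, ← Finset.sum_add_distrib]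
        refine Finset.sum_congr rfl fun k _ => ?_
        simp only [Pi.add_apply, Pi.smul_apply, Pi.sub_apply, smul_eq_mul]
        field_simp
        ring
      rw [this, hD]
      field_simp
    unfold moreauObj at h1
    rw [hquad] at h1
    have h5 : t * S ≤ t * (b - a + t * D) := by
      simp only [a] at hconv ⊢
      linarith
    exact le_of_mul_le_mul_left h5 ht
  have hlim : S ≤ b - a := by
    refine le_of_forall_pos_le_add fun ε hε => ?_
    have hpos : 0 < min 1 (ε / (D + 1)) := lt_min one_pos (by positivity)
    refine (key _ hpos (min_le_left _ _)).trans ?_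
    have : min 1 (ε / (D + 1)) * D ≤ ε := by
      calc min 1 (ε / (D + 1)) * D ≤ ε / (D + 1) * (D + 1) := by
            gcongr
            · exact min_le_right _ _
            · linarith
        _ = ε := by field_simp
    linarith
  -- Since `z - e = (z - u) - (e - u)`, the quadratic term is subtracted twice: one copy completes
  -- `a` to the envelope, the other is dropped.
  have hsplit : ∑ k, (e k - u k) / θ * (z k - e k) =
      S - 2 * ((∑ k, (e k - u k) ^ 2) / (2 * θ)) := by
    have : 2 * ((∑ k, (e k - u k) ^ 2) / (2 * θ)) = ∑ k, (e k - u k) / θ * (e k - u k) := by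
      rw [← mul_div_assoc, mul_div_mul_left _ _ two_ne_zero, Finset.sum_div]
      exact Finset.sum_congr rfl fun k _ => by ring
    rw [this, hS, ← Finset.sum_sub_distrib]
    exact Finset.sum_congr rfl fun k _ => by ring
  have hq : 0 ≤ (∑ k, (e k - u k) ^ 2) / (2 * θ) :=
    div_nonneg (Finset.sum_nonneg fun k _ => sq_nonneg _) (by positivity)
  rw [hu, hsplit]
  change _ ≤ b - (a + (∑ k, (e k - u k) ^ 2) / (2 * θ))
  linarith

/-- For a small parameter, the Moreau envelope of `N² / 2` is nearly `N² / 2`. -/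
lemma exists_moreau_parameter {N : Seminorm ℝ (K → ℝ)} {C : ℝ} (hC : ∀ e, N e ≤ C * ‖e‖)
    {t : ℝ} (ht : 0 < t) :
    ∃ θ : ℝ, 0 < θ ∧ ∀ e, N e ^ 2 / 2 ≤ (1 + t) * moreauEnv N θ e := by
  -- From `N e² ≤ (1 + t) N u² + (1 + 1/t) N (e - u)²`, the last term must be absorbed by the
  -- quadratic term, which needs `θ C² ≤ t`; the `+ 1` covers `C = 0`.
  refine ⟨t / (C ^ 2 + 1), by positivity, fun e => ?_⟩
  set θ := t / (C ^ 2 + 1) with hθdef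
  have hθ : 0 < θ := by positivity
  obtain ⟨u, hu⟩ := exists_moreauEnv_eq (seminorm_continuous_of_le hC) hθ e
  rw [hu]
  set q := ∑ k, (e k - u k) ^ 2
  have hq : N (e - u) ^ 2 ≤ C ^ 2 * q := by
    have h1 : N (e - u) ^ 2 ≤ (C * ‖e - u‖) ^ 2 := by
      gcongr
      exact hC _
    have h2 : ‖e - u‖ ^ 2 ≤ q := norm_sq_le_sum_sq (e - u)
    calc _ ≤ _ := h1
      _ = C ^ 2 * ‖e - u‖ ^ 2 := by ring
      _ ≤ _ := by gcongr
  have hq0 : 0 ≤ q := Finset.sum_nonneg fun k _ => sq_nonneg _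
  have htri : N e ≤ N u + N (e - u) := by
    simpa using map_add_le_add N u (e - u)
  have hsq : N e ^ 2 ≤ (1 + t) * N u ^ 2 + (1 + t) / t * N (e - u) ^ 2 := by
    have h1 : N e ^ 2 ≤ (N u + N (e - u)) ^ 2 := by gcongr
    have h2 : (1 + t) * N u ^ 2 + (1 + t) / t * N (e - u) ^ 2 - (N u + N (e - u)) ^ 2 =
        (t * N u - N (e - u)) ^ 2 / t := by
      field_simp
      ring
    have h3 : 0 ≤ (t * N u - N (e - u)) ^ 2 / t := by positivity
    linarith
  have hθq : (1 + t) / t * (C ^ 2 * q) ≤ (1 + t) * (q / θ) := by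
    have : (1 + t) * (q / θ) = (1 + t) / t * ((C ^ 2 + 1) * q) := by
      rw [hθdef]; field_simp
    rw [this]
    gcongr
    linarith
  have h6 : (1 + t) / t * N (e - u) ^ 2 ≤ (1 + t) / t * (C ^ 2 * q) := by gcongr
  unfold moreauObj
  have : (1 + t) * (N u ^ 2 / 2 + q / (2 * θ)) =
      ((1 + t) * N u ^ 2 + (1 + t) * (q / θ)) / 2 := by
    field_simp
  rw [this]
  linarith

/-- A smooth function that decreases along the steps of a map which contracts towards `0` in the
norm `N`. -/
theorem exists_lyapunov {N : Seminorm ℝ (K → ℝ)} {C κ : ℝ} (hN : ∀ e, ‖e‖ ≤ N e)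
    (hC : ∀ e, N e ≤ C * ‖e‖) (hκ0 : 0 ≤ κ) (hκ : κ < 1) :
    ∃ (V : (K → ℝ) → ℝ) (c B : ℝ), Measurable V ∧ (∀ e, 0 ≤ V e) ∧ 0 < c ∧ 0 < B ∧
      (∀ e, ‖e‖ ^ 2 ≤ B * V e) ∧
      ∀ e, ∃ G : K → ℝ, (∀ d, V (e + d) ≤ V e + ∑ k, G k * d k + B * ∑ k, d k ^ 2) ∧
        ∀ z, N z ≤ κ * N e → ∑ k, G k * (z k - e k) ≤ -c * V e := by
  -- Passing from `N² / 2` to the envelope costs a factor `1 + t`, which must not destroy the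
  -- contraction; the decay rate is then `1 - κ² (1 + t)`.
  obtain ⟨t, ht, hct⟩ : ∃ t : ℝ, 0 < t ∧ κ ^ 2 * (1 + t) < 1 := by
    refine ⟨(1 - κ ^ 2) / 2, ?_, ?_⟩
    · nlinarith
    · have h1 : 0 < 1 - κ ^ 2 := by nlinarith
      have h2 : 0 < (1 - κ ^ 2) * (1 - κ ^ 2 / 2) := mul_pos h1 (by linarith [sq_nonneg κ])
      linarith
  obtain ⟨θ, hθ, hθN⟩ := exists_moreau_parameter hC ht
  refine ⟨moreauEnv N θ, 1 - κ ^ 2 * (1 + t), max (2 * (1 + t)) (1 / (2 * θ)),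
    measurable_moreauEnv hθ, moreauEnv_nonneg N hθ, by linarith, ?_, fun e => ?_, fun e => ?_⟩
  · exact lt_max_of_lt_left (by linarith)
  · have h1 : ‖e‖ ^ 2 ≤ N e ^ 2 := by
      gcongr
      exact hN e
    have h2 : 2 * (1 + t) * moreauEnv N θ e ≤
        max (2 * (1 + t)) (1 / (2 * θ)) * moreauEnv N θ e := by
      gcongr
      · exact moreauEnv_nonneg N hθ e
      · exact le_max_left _ _
    linarith [hθN e]
  · obtain ⟨u, hu⟩ := exists_moreauEnv_eq (seminorm_continuous_of_le hC) hθ e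
    refine ⟨fun k => (e k - u k) / θ, fun d => ?_, fun z hz => ?_⟩
    · refine (moreauEnv_le N hθ _ u).trans ?_
      rw [moreauObj_add N hθ, hu, div_eq_inv_mul, ← one_div]
      have : 0 ≤ ∑ k, d k ^ 2 := Finset.sum_nonneg fun k _ => sq_nonneg _
      gcongr
      exact le_max_right _ _
    · refine (inner_le_of_moreauEnv_eq hθ hu z).trans ?_
      have h1 : N z ^ 2 ≤ (κ * N e) ^ 2 := by gcongr
      have h2 : κ ^ 2 * (N e ^ 2 / 2) ≤ κ ^ 2 * ((1 + t) * moreauEnv N θ e) := by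
        gcongr
        exact hθN e
      rw [mul_pow] at h1
      linarith

end Lyapunov

/-! ### Almost sure convergence under a drift condition -/

section Drift

variable {Ω : Type*} {m m0 : MeasurableSpace Ω} {μ : Measure Ω}

/-- Conditioning on `m` amounts to freezing `Z`: the pair (indicator of `A`, `Z`) is independent of
`Y`, so Tonelli integrates `Y` out first. Working in `ℝ≥0∞` avoids integrability conditions. -/
lemma setLIntegral_comp_le_of_indep {β E : Type*} [MeasurableSpace β] [MeasurableSpace E]
    [IsProbabilityMeasure μ] (hm : m ≤ m0) {Z : Ω → β}
    (hZ : Measurable[m] Z) {Y : Ω → E} (hY : Measurable Y)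
    (hind : Indep m (MeasurableSpace.comap Y inferInstance) μ) {g : β × E → ℝ≥0∞}
    (hg : Measurable g) {b : β → ℝ≥0∞} (hb : ∀ z, ∫⁻ y, g (z, y) ∂(μ.map Y) ≤ b z) {A : Set Ω}
    (hA : MeasurableSet[m] A) :
    ∫⁻ ω in A, g (Z ω, Y ω) ∂μ ≤ ∫⁻ ω in A, b (Z ω) ∂μ := by
  set I : Ω → ℝ≥0∞ := A.indicator fun _ => 1 with hI
  have hIm : Measurable[m] I :=
    @Measurable.indicator Ω ℝ≥0∞ A _ m _ _ (@measurable_const _ _ _ m 1) hA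
  have hIZm : Measurable[m] fun ω => (I ω, Z ω) := hIm.prodMk hZ
  have hIZ : Measurable fun ω => (I ω, Z ω) := hIZm.mono hm le_rfl
  have hindep : IndepFun (fun ω => (I ω, Z ω)) Y μ := by
    rw [IndepFun_iff_Indep]
    exact indep_of_indep_of_le_left hind hIZm.comap_le
  have hlaw := (indepFun_iff_map_prod_eq_prod_map_map hIZ.aemeasurable hY.aemeasurable).1 hindep
  have : IsProbabilityMeasure (μ.map Y) := Measure.isProbabilityMeasure_map hY.aemeasurable
  have hset : ∀ F : Ω → ℝ≥0∞, ∫⁻ ω in A, F ω ∂μ = ∫⁻ ω, I ω * F ω ∂μ := by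
    intro F
    rw [← lintegral_indicator (hm _ hA)]
    refine lintegral_congr fun ω => ?_
    by_cases h : ω ∈ A <;> simp [hI, h]
  have hG : Measurable fun z : (ℝ≥0∞ × β) × E => z.1.1 * g (z.1.2, z.2) := by fun_prop
  have hg' : ∀ z, Measurable fun y => g (z, y) := fun z => by fun_prop
  rw [hset, hset]
  calc ∫⁻ ω, I ω * g (Z ω, Y ω) ∂μ
      = ∫⁻ z, z.1.1 * g (z.1.2, z.2) ∂(μ.map fun ω => ((I ω, Z ω), Y ω)) :=
        (lintegral_map hG (hIZ.prodMk hY)).symm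
    _ = ∫⁻ w, ∫⁻ y, w.1 * g (w.2, y) ∂(μ.map Y) ∂(μ.map fun ω => (I ω, Z ω)) := by
        rw [hlaw, lintegral_prod _ hG.aemeasurable]
    _ = ∫⁻ w, w.1 * ∫⁻ y, g (w.2, y) ∂(μ.map Y) ∂(μ.map fun ω => (I ω, Z ω)) :=
        lintegral_congr fun w => lintegral_const_mul _ (hg' _)
    _ = ∫⁻ ω, I ω * ∫⁻ y, g (Z ω, y) ∂(μ.map Y) ∂μ := by
        refine lintegral_map (f := fun w : ℝ≥0∞ × β => w.1 * ∫⁻ y, g (w.2, y) ∂(μ.map Y)) ?_ hIZ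
        exact measurable_fst.mul (hg.lintegral_prod_right'.comp measurable_snd)
    _ ≤ ∫⁻ ω, I ω * b (Z ω) ∂μ := by
        refine lintegral_mono fun ω => ?_
        dsimp only
        gcongr
        exact hb _

/-- A positive limit would make `γ` itself summable. -/
lemma tendsto_zero_of_summable_mul {γ v : ℕ → ℝ} (hγ : RobbinsMonro γ) {l : ℝ}
    (hv : ∀ n, 0 ≤ v n) (hl : Tendsto v atTop (𝓝 l)) (hs : Summable fun n => γ n * v n) :
    Tendsto v atTop (𝓝 0) := by
  have hl0 : 0 ≤ l := ge_of_tendsto' hl hv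
  rcases hl0.eq_or_lt with h | h
  · rwa [h]
  exfalso
  have hev : ∀ᶠ n in atTop, l / 2 < v n := hl.eventually_const_lt (by linarith)
  have hγs : Summable γ := by
    refine Summable.of_norm_bounded_eventually_nat (g := fun n => 2 / l * (γ n * v n))
      (hs.mul_left _) ?_
    filter_upwards [hev] with n hn
    rw [Real.norm_of_nonneg (hγ.nonneg n)]
    have : γ n * (l / 2) ≤ γ n * v n := mul_le_mul_of_nonneg_left hn.le (hγ.nonneg n)
    calc γ n = 2 / l * (γ n * (l / 2)) := by field_simp
      _ ≤ _ := by gcongr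
  exact not_tendsto_nhds_of_tendsto_atTop hγ.sum_eq_top _ hγs.hasSum.tendsto_sum_nat

/-- Convergence to zero of a nonnegative process with conditional drift at most
`-c γ V + D γ² (1 + V)`. -/
theorem tendsto_zero_of_drift [IsProbabilityMeasure μ] {ℱ : Filtration ℕ m0} {V : ℕ → Ω → ℝ}
    (hadp : StronglyAdapted ℱ V) (hinteg : ∀ n, Integrable (V n) μ) (hV : ∀ n ω, 0 ≤ V n ω)
    {γ : ℕ → ℝ} (hγ : RobbinsMonro γ) {c D : ℝ} (hc : 0 < c) (hD : 0 ≤ D)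
    (hdrift : ∀ n (s : Set Ω), MeasurableSet[ℱ n] s → ∫ ω in s, V (n + 1) ω ∂μ ≤
      ∫ ω in s, ((1 - c * γ n + D * γ n ^ 2) * V n ω + D * γ n ^ 2) ∂μ) :
    ∀ᵐ ω ∂μ, Tendsto (fun n => V n ω) atTop (𝓝 0) := by
  -- Dividing by `p` absorbs the growth term `D γ² V`; square summability keeps `p` bounded.
  set p : ℕ → ℝ := fun n => ∏ i ∈ Finset.range n, (1 + D * γ i ^ 2) with hp
  have hfac : ∀ i, 1 ≤ 1 + D * γ i ^ 2 := fun i => by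
    have : 0 ≤ D * γ i ^ 2 := by positivity
    linarith
  have hpsucc : ∀ n, p (n + 1) = p n * (1 + D * γ n ^ 2) := fun n => Finset.prod_range_succ _ _
  have hp1 : ∀ n, 1 ≤ p n := fun n => by
    induction n with
    | zero => simp [hp]
    | succ n ih => rw [hpsucc]; exact one_le_mul_of_one_le_of_one_le ih (hfac n)
  have hp0 : ∀ n, 0 < p n := fun n => one_pos.trans_le (hp1 n)
  have hpmono : Monotone p := monotone_nat_of_le_succ fun n => by
    rw [hpsucc]
    exact le_mul_of_one_le_right (hp0 n).le (hfac n)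
  set T : ℝ := ∑' n, γ n ^ 2
  have hT : ∀ n, ∑ i ∈ Finset.range n, γ i ^ 2 ≤ T := fun n =>
    hγ.sum_sq.sum_le_tsum _ fun i _ => sq_nonneg _
  have hpbd : ∀ n, p n ≤ Real.exp (D * T) := fun n => by
    calc p n ≤ ∏ i ∈ Finset.range n, Real.exp (D * γ i ^ 2) :=
          Finset.prod_le_prod (fun i _ => by linarith [hfac i]) fun i _ => by
            rw [add_comm]; exact Real.add_one_le_exp _
      _ = Real.exp (D * ∑ i ∈ Finset.range n, γ i ^ 2) := by
          rw [← Real.exp_sum, Finset.mul_sum]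
      _ ≤ _ := by gcongr; exact hT n
  obtain ⟨pl, hpl⟩ : ∃ l, Tendsto p atTop (𝓝 l) :=
    ⟨_, tendsto_atTop_ciSup hpmono ⟨_, by rintro _ ⟨n, rfl⟩; exact hpbd n⟩⟩
  set S : ℕ → Ω → ℝ := fun n ω => ∑ i ∈ Finset.range n, c * γ i * V i ω / p (i + 1) with hS
  -- `S` collects the guaranteed decrease, and the tail of `D ∑ γ²` pays in advance for the additive
  -- noise, so `W` is a nonnegative supermartingale.
  set W : ℕ → Ω → ℝ := fun n ω =>
    V n ω / p n + S n ω + D * (T - ∑ i ∈ Finset.range n, γ i ^ 2) with hW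
  have hterm : ∀ i ω, 0 ≤ c * γ i * V i ω / p (i + 1) := fun i ω =>
    div_nonneg (mul_nonneg (mul_nonneg hc.le (hγ.nonneg i)) (hV i ω)) (hp0 _).le
  have hSint : ∀ n, Integrable (S n) μ := fun n =>
    integrable_finsetSum _ fun i _ => ((hinteg i).const_mul _).div_const _
  have hWint : ∀ n, Integrable (W n) μ := fun n =>
    (((hinteg n).div_const _).add (hSint n)).add (integrable_const _)
  have hWadp : StronglyAdapted ℱ W := fun n => by
    refine Measurable.stronglyMeasurable ?_
    have h1 : ∀ i ≤ n, Measurable[ℱ n] (V i) := fun i hi =>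
      ((hadp i).mono (ℱ.mono hi)).measurable
    refine (((h1 n le_rfl).div_const _).add ?_).add measurable_const
    refine Finset.measurable_sum _ fun i hi => ?_
    exact ((h1 i (Finset.mem_range.1 hi).le).const_mul _).div_const _
  have hsuper : Supermartingale W ℱ μ := by
    refine supermartingale_of_setIntegral_succ_le hWadp hWint fun n s hs => ?_
    have hd := hdrift n s hs
    have hi : ∀ {F : Ω → ℝ}, Integrable F μ → Integrable F (μ.restrict s) := fun h => h.restrict
    have hF : Integrable (fun ω => (1 - c * γ n + D * γ n ^ 2) * V n ω + D * γ n ^ 2) μ :=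
      ((hinteg n).const_mul _).add (integrable_const _)
    have e1 : ∫ ω in s, (W n ω - W (n + 1) ω) ∂μ =
        (∫ ω in s, ((1 - c * γ n + D * γ n ^ 2) * V n ω + D * γ n ^ 2) ∂μ -
          ∫ ω in s, V (n + 1) ω ∂μ) / p (n + 1) +
        ∫ ω in s, D * γ n ^ 2 * (1 - 1 / p (n + 1)) ∂μ := by
      rw [← integral_sub (hi hF) (hi (hinteg _)),
        ← integral_div, ← integral_add]
      · refine integral_congr_ae (Eventually.of_forall fun ω => ?_)
        have h1 : p (n + 1) ≠ 0 := (hp0 _).ne'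
        have h2 : V n ω / p n = (1 + D * γ n ^ 2) * V n ω / p (n + 1) := by
          rw [hpsucc]
          have := (hp0 n).ne'
          have : 1 + D * γ n ^ 2 ≠ 0 := by linarith [hfac n]
          field_simp
        simp only [hW, hS, Finset.sum_range_succ]
        rw [h2]
        field_simp
        ring
      · exact ((hi hF).sub (hi (hinteg _))).div_const _
      · exact integrable_const _
    have e2 : 0 ≤ ∫ ω in s, D * γ n ^ 2 * (1 - 1 / p (n + 1)) ∂μ := by
      refine integral_nonneg fun ω => ?_
      have : 1 / p (n + 1) ≤ 1 := by
        rw [div_le_one (hp0 _)]; exact hp1 _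
      exact mul_nonneg (by positivity) (by linarith)
    have e3 := div_nonneg (sub_nonneg.2 hd) (hp0 (n + 1)).le
    rw [integral_sub (hi (hWint _)) (hi (hWint _))] at e1
    linarith
  have hW0 : ∀ n ω, 0 ≤ W n ω := fun n ω =>
    add_nonneg (add_nonneg (div_nonneg (hV n ω) (hp0 n).le)
      (Finset.sum_nonneg fun i _ => hterm i ω)) (mul_nonneg hD (by linarith [hT n]))
  have hbdd : ∀ n, eLpNorm ((-W) n) 1 μ ≤ ((∫ ω, W 0 ω ∂μ).toNNReal : ℝ≥0∞) := fun n => by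
    rw [Pi.neg_apply, eLpNorm_neg, eLpNorm_one_eq_lintegral_enorm]
    have : ∫⁻ ω, ‖W n ω‖ₑ ∂μ = ENNReal.ofReal (∫ ω, W n ω ∂μ) := by
      rw [ofReal_integral_eq_lintegral_ofReal (hWint n) (Eventually.of_forall (hW0 n))]
      refine lintegral_congr fun ω => ?_
      rw [Real.enorm_eq_ofReal (hW0 n ω)]
    rw [this]
    refine ENNReal.ofReal_le_ofReal ?_
    have := hsuper.setIntegral_le (Nat.zero_le n) MeasurableSet.univ
    simpa using this
  filter_upwards [hsuper.neg.exists_ae_tendsto_of_bdd hbdd] with ω hω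
  obtain ⟨w', hw'⟩ := hω
  have hw : Tendsto (fun n => W n ω) atTop (𝓝 (-w')) := by
    simpa using hw'.neg
  have hSmono : Monotone fun n => S n ω := monotone_nat_of_le_succ fun n => by
    simp only [hS, Finset.sum_range_succ]
    linarith [hterm n ω]
  obtain ⟨Bw, hBw⟩ := hw.bddAbove_range
  have hSle : ∀ n, S n ω ≤ Bw := fun n => by
    have h1 : W n ω ≤ Bw := hBw ⟨n, rfl⟩
    have h2 : 0 ≤ V n ω / p n := div_nonneg (hV n ω) (hp0 n).le
    have h3 : 0 ≤ D * (T - ∑ i ∈ Finset.range n, γ i ^ 2) := mul_nonneg hD (by linarith [hT n])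
    simp only [hW] at h1
    linarith
  have hSlim : Tendsto (fun n => S n ω) atTop (𝓝 (⨆ n, S n ω)) :=
    tendsto_atTop_ciSup hSmono ⟨Bw, by rintro _ ⟨n, rfl⟩; exact hSle n⟩
  have hsum : Summable fun n => c * γ n * V n ω / p (n + 1) :=
    summable_of_sum_range_le (fun n => hterm n ω) hSle
  have htail : Tendsto (fun n => D * (T - ∑ i ∈ Finset.range n, γ i ^ 2)) atTop (𝓝 (D * (T - T))) :=
    (tendsto_const_nhds.sub hγ.sum_sq.hasSum.tendsto_sum_nat).const_mul D
  -- `W`, the bounded increasing `S`, the tail and `p` all converge, hence so does `V`; boundedness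
  -- of `S` then gives summability of `γ V`, which identifies the limit.
  have hVlim : Tendsto (fun n => V n ω) atTop
      (𝓝 ((-w' - (⨆ n, S n ω) - D * (T - T)) * pl)) := by
    refine (((hw.sub hSlim).sub htail).mul hpl).congr fun n => ?_
    simp only [hW]
    have := (hp0 n).ne'
    field_simp
    ring
  refine tendsto_zero_of_summable_mul hγ (fun n => hV n ω) hVlim ?_
  refine Summable.of_nonneg_of_le (fun n => mul_nonneg (hγ.nonneg n) (hV n ω)) (fun n => ?_)
    (hsum.mul_left (Real.exp (D * T) / c))
  have h1 : 0 ≤ γ n * V n ω := mul_nonneg (hγ.nonneg n) (hV n ω)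
  have h2 : Real.exp (D * T) / c * (c * γ n * V n ω / p (n + 1)) =
      γ n * V n ω * (Real.exp (D * T) / p (n + 1)) := by
    field_simp
  rw [h2]
  refine le_mul_of_one_le_right h1 ?_
  rw [one_le_div (hp0 _)]
  exact hpbd _

end Drift

/-! ### Stochastic approximation of the fixed point of a contraction -/

section StochasticApproximation

/-- The σ-algebras generated by the past of the sequence `ξ`, the present excluded. -/
def pastFiltration {Ω E : Type*} {m0 : MeasurableSpace Ω} [MeasurableSpace E] (ξ : ℕ → Ω → E)
    (hξ : ∀ n, Measurable (ξ n)) : Filtration ℕ m0 where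
  seq n := ⨆ i ∈ Set.Iio n, MeasurableSpace.comap (ξ i) inferInstance
  mono' _ _ h := biSup_mono fun _ hi => lt_of_lt_of_le hi h
  le' _ := iSup₂_le fun i _ => (hξ i).comap_le

variable {K E Ω : Type*} [Fintype K] [MeasurableSpace E] {m0 : MeasurableSpace Ω}

lemma measurable_pastFiltration {ξ : ℕ → Ω → E} (hξ : ∀ n, Measurable (ξ n)) {i n : ℕ}
    (hi : i < n) : Measurable[pastFiltration ξ hξ n] (ξ i) :=
  measurable_iff_comap_le.2
    (le_iSup₂_of_le (f := fun i (_ : i ∈ Set.Iio n) =>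
      MeasurableSpace.comap (ξ i) inferInstance) i hi le_rfl)

lemma indep_pastFiltration {μ : Measure Ω} {ξ : ℕ → Ω → E} (hξ : ∀ n, Measurable (ξ n))
    (hind : iIndepFun ξ μ) (n : ℕ) :
    Indep (pastFiltration ξ hξ n) (MeasurableSpace.comap (ξ n) inferInstance) μ := by
  have h := indep_iSup_of_disjoint (fun i => (hξ i).comap_le) hind
    (S := Set.Iio n) (T := {n}) (by simp)
  rwa [iSup_singleton] at h

/-- The bias–variance decomposition. -/
lemma integral_sub_const_sq {η : Measure E} [IsProbabilityMeasure η] {Y : E → ℝ}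
    (hY : MemLp Y 2 η) (r : ℝ) :
    ∫ y, (Y y - r) ^ 2 ∂η = variance Y η + (∫ y, Y y ∂η - r) ^ 2 := by
  have h := variance_eq_sub (hY.sub (memLp_const r))
  have h1 : variance (Y - fun _ => r) η = variance Y η :=
    variance_sub_const hY.aestronglyMeasurable r
  have h2 : ∫ y, (Y - fun _ => r : E → ℝ) y ∂η = ∫ y, Y y ∂η - r := by
    simp only [Pi.sub_apply]
    rw [integral_sub (hY.integrable one_le_two) (integrable_const _)]
    simp
  rw [h1, h2] at h
  simp only [Pi.pow_apply, Pi.sub_apply] at h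
  linarith

/-- One step of the drift condition, with the current iterate `q` frozen. -/
lemma lintegral_lyapunov_step_le {η : Measure E} [IsProbabilityMeasure η]
    {N : Seminorm ℝ (K → ℝ)} {C κ : ℝ} (hN : ∀ e, ‖e‖ ≤ N e) (hC : ∀ e, N e ≤ C * ‖e‖)
    (hκ : κ < 1) {V : (K → ℝ) → ℝ} {c B : ℝ} (hV : ∀ e, 0 ≤ V e) (hB : 0 < B)
    (hVB : ∀ e, ‖e‖ ^ 2 ≤ B * V e)
    (hG : ∀ e, ∃ G : K → ℝ, (∀ d, V (e + d) ≤ V e + ∑ k, G k * d k + B * ∑ k, d k ^ 2) ∧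
        ∀ z, N z ≤ κ * N e → ∑ k, G k * (z k - e k) ≤ -c * V e)
    {qs q z : K → ℝ} (hz : N (z - qs) ≤ κ * N (q - qs)) {Y : E → K → ℝ}
    (hY : ∀ k, MemLp (fun y => Y y k) 2 η) (hmean : ∀ k, ∫ y, Y y k ∂η = z k) {D : ℝ} (hD : 0 ≤ D)
    (hvar : ∀ k, variance (fun y => Y y k) η ≤ D * (1 + ‖q‖ ^ 2)) {γ : ℝ} (hγ : 0 ≤ γ) :
    0 ≤ (1 - c * γ +
          B * (Fintype.card K * (D * (1 + 2 * ‖qs‖ ^ 2) + (2 * D + 4 * C ^ 2) * B)) * γ ^ 2) *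
            V (q - qs) +
          B * (Fintype.card K * (D * (1 + 2 * ‖qs‖ ^ 2) + (2 * D + 4 * C ^ 2) * B)) * γ ^ 2 ∧
    ∫⁻ y, ENNReal.ofReal (V (q + γ • (Y y - q) - qs)) ∂η ≤
      ENNReal.ofReal ((1 - c * γ +
          B * (Fintype.card K * (D * (1 + 2 * ‖qs‖ ^ 2) + (2 * D + 4 * C ^ 2) * B)) * γ ^ 2) *
            V (q - qs) +
          B * (Fintype.card K * (D * (1 + 2 * ‖qs‖ ^ 2) + (2 * D + 4 * C ^ 2) * B)) * γ ^ 2) := by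
  set e := q - qs with he
  obtain ⟨G, hG1, hG2⟩ := hG e
  set F : E → ℝ := fun y => V e + ∑ k, G k * (γ * (Y y k - q k)) +
    B * ∑ k, (γ * (Y y k - q k)) ^ 2 with hF
  have hstep : ∀ y, V (q + γ • (Y y - q) - qs) ≤ F y := fun y => by
    have : q + γ • (Y y - q) - qs = e + γ • (Y y - q) := by rw [he]; abel
    rw [this]
    exact hG1 _
  have hi1 : ∀ k, Integrable (fun y => G k * (γ * (Y y k - q k))) η := fun k =>
    ((((hY k).integrable one_le_two).sub (integrable_const _)).const_mul _).const_mul _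
  have hi2 : ∀ k, Integrable (fun y => (γ * (Y y k - q k)) ^ 2) η := fun k =>
    (((hY k).sub (memLp_const (q k))).const_mul γ).integrable_sq
  have hi3 : Integrable (fun y => ∑ k, G k * (γ * (Y y k - q k))) η :=
    integrable_finsetSum _ fun k _ => hi1 k
  have hi4 : Integrable (fun y => ∑ k, (γ * (Y y k - q k)) ^ 2) η :=
    integrable_finsetSum _ fun k _ => hi2 k
  have hFi : Integrable F η := ((integrable_const _).add hi3).add (hi4.const_mul _)
  have hF0 : ∀ y, 0 ≤ F y := fun y => (hV _).trans (hstep y)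
  -- The majorant `F` is nonnegative, so bounding its integral also shows that the bound is
  -- nonnegative and that `ENNReal.ofReal` does not truncate it.
  suffices hsuff : ∫ y, F y ∂η ≤ _ from
    ⟨(integral_nonneg hF0).trans hsuff, calc
      ∫⁻ y, ENNReal.ofReal (V (q + γ • (Y y - q) - qs)) ∂η
        ≤ ∫⁻ y, ENNReal.ofReal (F y) ∂η :=
          lintegral_mono fun y => ENNReal.ofReal_le_ofReal (hstep y)
      _ = ENNReal.ofReal (∫ y, F y ∂η) :=
          (ofReal_integral_eq_lintegral_ofReal hFi (Eventually.of_forall hF0)).symm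
      _ ≤ _ := ENNReal.ofReal_le_ofReal hsuff⟩
  have hinteg : ∫ y, F y ∂η = V e + γ * ∑ k, G k * (z k - q k) +
      B * ∑ k, γ ^ 2 * (variance (fun y => Y y k) η + (z k - q k) ^ 2) := by
    have a1 : ∫ y, F y ∂η = ∫ y, (V e + ∑ k, G k * (γ * (Y y k - q k))) ∂η +
        ∫ y, B * ∑ k, (γ * (Y y k - q k)) ^ 2 ∂η :=
      integral_add ((integrable_const _).add hi3) (hi4.const_mul _)
    have a2 : ∫ y, (V e + ∑ k, G k * (γ * (Y y k - q k))) ∂η =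
        V e + ∫ y, ∑ k, G k * (γ * (Y y k - q k)) ∂η := by
      rw [integral_add (integrable_const _) hi3]
      simp
    rw [a1, a2, integral_const_mul, integral_finsetSum _ fun k _ => hi1 k,
      integral_finsetSum _ fun k _ => hi2 k, Finset.mul_sum Finset.univ _ γ]
    congr 2
    · refine Finset.sum_congr rfl fun k _ => ?_
      rw [integral_const_mul, integral_const_mul,
        integral_sub ((hY k).integrable one_le_two) (integrable_const _), hmean]
      simp
      ring
    · refine Finset.sum_congr rfl fun k _ => ?_
      simp_rw [mul_pow]
      rw [integral_const_mul, integral_sub_const_sq (hY k), hmean]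
  have hzq : ∀ k, z k - q k = (z - qs) k - e k := fun k => by simp [he]
  have hlin : ∑ k, G k * (z k - q k) ≤ -c * V e := by
    simp_rw [hzq]
    exact hG2 _ hz
  -- Both `z` and `q` are within `N e` of `qs` in the norm `N`, whence the factor `2 C` before
  -- squaring.
  have hbias : ‖z - q‖ ^ 2 ≤ 4 * C ^ 2 * ‖e‖ ^ 2 := by
    have h1 : ‖z - q‖ ≤ 2 * (C * ‖e‖) := by
      have h2 : z - q = (z - qs) - e := by rw [he]; abel
      have h3 : N (z - q) ≤ N (z - qs) + N e := by rw [h2]; exact map_sub_le_add N _ _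
      have h4 : κ * N e ≤ 1 * N e := mul_le_mul_of_nonneg_right hκ.le (apply_nonneg N e)
      linarith [hN (z - q), hC e]
    calc ‖z - q‖ ^ 2 ≤ (2 * (C * ‖e‖)) ^ 2 := by gcongr
      _ = _ := by ring
  have hqn : ‖q‖ ^ 2 ≤ 2 * ‖e‖ ^ 2 + 2 * ‖qs‖ ^ 2 := by
    have h1 : ‖q‖ ≤ ‖e‖ + ‖qs‖ := by
      have : q = e + qs := by rw [he]; abel
      calc ‖q‖ = ‖e + qs‖ := by rw [← this]
        _ ≤ _ := norm_add_le _ _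
    have h2 : ‖q‖ ^ 2 ≤ (‖e‖ + ‖qs‖) ^ 2 := by gcongr
    linarith [add_sq ‖e‖ ‖qs‖, two_mul_le_add_sq ‖e‖ ‖qs‖]
  have hterm : ∀ k ∈ Finset.univ, γ ^ 2 * (variance (fun y => Y y k) η + (z k - q k) ^ 2) ≤
      γ ^ 2 * (D * (1 + 2 * ‖qs‖ ^ 2) + (2 * D + 4 * C ^ 2) * ‖e‖ ^ 2) := fun k _ => by
    have h1 : (z k - q k) ^ 2 ≤ ‖z - q‖ ^ 2 := by
      rw [← sq_abs]
      have := norm_le_pi_norm (z - q) k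
      rw [Real.norm_eq_abs] at this
      gcongr
      exact this
    have h2 : D * (1 + ‖q‖ ^ 2) ≤ D * (1 + (2 * ‖e‖ ^ 2 + 2 * ‖qs‖ ^ 2)) := by gcongr
    refine mul_le_mul_of_nonneg_left ?_ (sq_nonneg γ)
    linarith [hvar k]
  have hsum := Finset.sum_le_sum hterm
  rw [Finset.sum_const, Finset.card_univ, nsmul_eq_mul] at hsum
  have hve : (2 * D + 4 * C ^ 2) * ‖e‖ ^ 2 ≤ (2 * D + 4 * C ^ 2) * (B * V e) := by
    gcongr
    exact hVB e
  have hb1 : B * ∑ k, γ ^ 2 * (variance (fun y => Y y k) η + (z k - q k) ^ 2) ≤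
      B * (Fintype.card K * (γ ^ 2 * (D * (1 + 2 * ‖qs‖ ^ 2) +
        (2 * D + 4 * C ^ 2) * (B * V e)))) := by
    refine mul_le_mul_of_nonneg_left (hsum.trans ?_) hB.le
    gcongr
  have hb2 : B * (Fintype.card K * (γ ^ 2 * (D * (1 + 2 * ‖qs‖ ^ 2) +
        (2 * D + 4 * C ^ 2) * (B * V e)))) ≤
      B * (Fintype.card K * (D * (1 + 2 * ‖qs‖ ^ 2) + (2 * D + 4 * C ^ 2) * B)) * γ ^ 2 * V e +
      B * (Fintype.card K * (D * (1 + 2 * ‖qs‖ ^ 2) + (2 * D + 4 * C ^ 2) * B)) * γ ^ 2 := by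
    have hve0 := hV e
    have p1 : 0 ≤ B * (Fintype.card K * (D * (1 + 2 * ‖qs‖ ^ 2))) * γ ^ 2 * V e := by positivity
    have p2 : 0 ≤ B * (Fintype.card K * ((2 * D + 4 * C ^ 2) * B)) * γ ^ 2 := by positivity
    linarith
  have hb3 : γ * ∑ k, G k * (z k - q k) ≤ γ * (-c * V e) := mul_le_mul_of_nonneg_left hlin hγ
  rw [hinteg]
  linarith


/-- Stochastic approximation with step sizes `γ` converges to `qs` if its mean map contracts
towards `qs` in the norm `N`, and its noise has at most quadratic variance. -/
theorem stochasticApproximation {N : Seminorm ℝ (K → ℝ)} {C κ : ℝ} (hN : ∀ e, ‖e‖ ≤ N e)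
    (hC : ∀ e, N e ≤ C * ‖e‖) (hκ0 : 0 ≤ κ) (hκ : κ < 1) {Φ : (K → ℝ) → K → ℝ} {qs : K → ℝ}
    (hΦ : ∀ q, N (Φ q - qs) ≤ κ * N (q - qs)) {η : Measure E} {Y : (K → ℝ) → E → K → ℝ}
    (hYm : Measurable (Function.uncurry Y)) (hY : ∀ q k, MemLp (fun y => Y q y k) 2 η)
    (hmean : ∀ q k, ∫ y, Y q y k ∂η = Φ q k) {D : ℝ} (hD : 0 ≤ D)
    (hvar : ∀ q k, variance (fun y => Y q y k) η ≤ D * (1 + ‖q‖ ^ 2))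
    {γ : ℕ → ℝ} (hγ : RobbinsMonro γ) {μ : Measure Ω}
    [IsProbabilityMeasure μ] {ξ : ℕ → Ω → E} (hξ : ∀ n, Measurable (ξ n))
    (hlaw : ∀ n, μ.map (ξ n) = η) (hind : iIndepFun ξ μ) {Q : ℕ → Ω → K → ℝ} {q₀ : K → ℝ}
    (hQ0 : ∀ ω, Q 0 ω = q₀)
    (hQ : ∀ n ω, Q (n + 1) ω = Q n ω + γ n • (Y (Q n ω) (ξ n ω) - Q n ω)) :
    ∀ᵐ ω ∂μ, Tendsto (fun n => Q n ω) atTop (𝓝 qs) := by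
  obtain ⟨V, c, B, hVm, hV, hc, hB, hVB, hG⟩ := exists_lyapunov hN hC hκ0 hκ
  have hη : IsProbabilityMeasure η := by
    rw [← hlaw 0]; exact Measure.isProbabilityMeasure_map (hξ 0).aemeasurable
  set ℱ := pastFiltration ξ hξ
  set D' := B * (Fintype.card K * (D * (1 + 2 * ‖qs‖ ^ 2) + (2 * D + 4 * C ^ 2) * B))
  have hD' : 0 ≤ D' := by positivity
  set b : ℕ → (K → ℝ) → ℝ := fun n q =>
    (1 - c * γ n + D' * γ n ^ 2) * V (q - qs) + D' * γ n ^ 2 with hb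
  have hone : ∀ n q, 0 ≤ b n q ∧ ∫⁻ y, ENNReal.ofReal (V (q + γ n • (Y q y - q) - qs)) ∂η ≤
      ENNReal.ofReal (b n q) := fun n q =>
    lintegral_lyapunov_step_le hN hC hκ hV hB hVB hG (hΦ q) (hY q) (hmean q) hD (hvar q)
      (hγ.nonneg n)
  have hbpos : ∀ n q, 0 ≤ b n q := fun n q => (hone n q).1
  have hstepm : ∀ n, Measurable fun z : (K → ℝ) × E => z.1 + γ n • (Y z.1 z.2 - z.1) := fun n => by
    have : Measurable fun z : (K → ℝ) × E => Y z.1 z.2 := hYm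
    fun_prop
  have hQm : ∀ n, Measurable[ℱ n] (Q n) := fun n => by
    induction n with
    | zero =>
      have : Q 0 = fun _ => q₀ := funext hQ0
      rw [this]; exact measurable_const
    | succ n ih =>
      have h1 : Measurable[ℱ (n + 1)] (Q n) := ih.mono (ℱ.mono (Nat.le_succ n)) le_rfl
      have h2 : Measurable[ℱ (n + 1)] (ξ n) := measurable_pastFiltration hξ (Nat.lt_succ_self n)
      have : Q (n + 1) = (fun z : (K → ℝ) × E => z.1 + γ n • (Y z.1 z.2 - z.1)) ∘
          fun ω => (Q n ω, ξ n ω) := funext fun ω => hQ n ω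
      rw [this]
      exact (hstepm n).comp (h1.prodMk h2)
  have hstep : ∀ n (s : Set Ω), MeasurableSet[ℱ n] s →
      ∫⁻ ω in s, ENNReal.ofReal (V (Q (n + 1) ω - qs)) ∂μ ≤
        ∫⁻ ω in s, ENNReal.ofReal (b n (Q n ω)) ∂μ := fun n s hs => by
    simp_rw [hQ n]
    refine setLIntegral_comp_le_of_indep (ℱ.le n) (hQm n) (hξ n) (indep_pastFiltration hξ hind n)
      (g := fun z => ENNReal.ofReal (V (z.1 + γ n • (Y z.1 z.2 - z.1) - qs)))
      (b := fun q => ENNReal.ofReal (b n q)) ?_ (fun q => ?_) hs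
    · exact (hVm.comp ((hstepm n).sub_const qs)).ennreal_ofReal
    · rw [hlaw n]
      exact (hone n q).2
  have hVQm : ∀ n, Measurable[ℱ n] fun ω => V (Q n ω - qs) := fun n =>
    hVm.comp ((hQm n).sub_const qs)
  have hVQm0 : ∀ n, Measurable fun ω => V (Q n ω - qs) := fun n =>
    (hVQm n).mono (ℱ.le n) le_rfl
  have hbint : ∀ n, Integrable (fun ω => V (Q n ω - qs)) μ → Integrable (fun ω => b n (Q n ω)) μ :=
    fun n h => (h.const_mul _).add (integrable_const _)
  -- Integrability propagates from step to step through the drift inequality itself, applied on the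
  -- whole space.
  have hinteg : ∀ n, Integrable (fun ω => V (Q n ω - qs)) μ := fun n => by
    induction n with
    | zero => simp_rw [hQ0]; exact integrable_const _
    | succ n ih =>
      refine ⟨(hVQm0 _).aestronglyMeasurable, ?_⟩
      rw [hasFiniteIntegral_iff_ofReal (Eventually.of_forall fun ω => hV _)]
      have h := hstep n Set.univ MeasurableSet.univ
      rw [setLIntegral_univ, setLIntegral_univ] at h
      exact h.trans_lt (hbint n ih).lintegral_lt_top
  have hzero : ∀ᵐ ω ∂μ, Tendsto (fun n => V (Q n ω - qs)) atTop (𝓝 0) := by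
    refine tendsto_zero_of_drift (ℱ := ℱ) (fun n => (hVQm n).stronglyMeasurable) hinteg
      (fun n ω => hV _) hγ hc hD' fun n s hs => ?_
    have h := hstep n s hs
    rw [← ofReal_integral_eq_lintegral_ofReal (hinteg _).restrict
        (Eventually.of_forall fun ω => hV _),
      ← ofReal_integral_eq_lintegral_ofReal (hbint n (hinteg n)).restrict
        (Eventually.of_forall fun ω => hbpos n _)] at h
    exact (ENNReal.ofReal_le_ofReal_iff (integral_nonneg fun ω => hbpos n _)).1 h
  filter_upwards [hzero] with ω hω
  have h1 : Tendsto (fun n => B * V (Q n ω - qs)) atTop (𝓝 0) := by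
    simpa using hω.const_mul B
  have h2 : Tendsto (fun n => ‖Q n ω - qs‖ ^ 2) atTop (𝓝 0) :=
    squeeze_zero (fun n => by positivity) (fun n => hVB _) h1
  have h3 : Tendsto (fun n => ‖Q n ω - qs‖) atTop (𝓝 0) := by
    have := h2.sqrt
    simpa [Real.sqrt_sq (norm_nonneg _)] using this
  exact tendsto_iff_norm_sub_tendsto_zero.2 h3

end StochasticApproximation

/-! ### Expectations and laws on finite probability spaces -/

section Expect

variable {Ω : Type*} [Fintype Ω] (p : stdSimplex ℝ Ω)

lemma expect_add (v w : Ω → ℝ) :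
    expect p (fun ω => v ω + w ω) = expect p v + expect p w := by
  simp only [expect, mul_add, Finset.sum_add_distrib]

lemma expect_sub (v w : Ω → ℝ) :
    expect p (fun ω => v ω - w ω) = expect p v - expect p w := by
  simp only [expect, mul_sub, Finset.sum_sub_distrib]

lemma expect_const_mul (r : ℝ) (v : Ω → ℝ) :
    expect p (fun ω => r * v ω) = r * expect p v := by
  simp only [expect, Finset.mul_sum]
  exact Finset.sum_congr rfl fun ω _ => by ring

lemma expect_const (r : ℝ) : expect p (fun _ => r) = r := by
  simp only [expect, ← Finset.sum_mul, p.2.2, one_mul]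

variable {p}

lemma expect_mono {v w : Ω → ℝ} (h : ∀ ω, 0 < p.1 ω → v ω ≤ w ω) : expect p v ≤ expect p w := by
  refine Finset.sum_le_sum fun ω _ => ?_
  rcases (p.2.1 ω).eq_or_lt with h0 | h0
  · simp [← h0]
  · exact mul_le_mul_of_nonneg_left (h ω h0) h0.le

lemma expect_nonneg {v : Ω → ℝ} (h : 0 ≤ v) : 0 ≤ expect p v :=
  Finset.sum_nonneg fun ω _ => mul_nonneg (p.2.1 ω) (h ω)

/-- `ρ` has slopes between `δ` and `L` along increments, measured by the expectation. -/
def HasSlopes (p : stdSimplex ℝ Ω) (ρ : (Ω → ℝ) → ℝ) (δ L : ℝ) : Prop :=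
  ∀ v w : Ω → ℝ, w ≤ v →
    δ * expect p (fun ω => v ω - w ω) ≤ ρ v - ρ w ∧ ρ v - ρ w ≤ L * expect p (fun ω => v ω - w ω)

/-- Slopes compare only ordered pairs, so one passes through `v ⊔ w`: going up from `v` does not
decrease `ρ`, and going down to `w` costs at most `L E[(v - w)⁺]`. -/
lemma HasSlopes.abs_sub_le {ρ : (Ω → ℝ) → ℝ} {δ L : ℝ} (h : HasSlopes p ρ δ L) (hδ : 0 ≤ δ)
    (hL : 0 ≤ L) (v w : Ω → ℝ) : |ρ v - ρ w| ≤ L * expect p (fun ω => |v ω - w ω|) := by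
  have key : ∀ v w : Ω → ℝ, ρ v - ρ w ≤ L * expect p (fun ω => |v ω - w ω|) := by
    intro v w
    have h1 := (h (v ⊔ w) v le_sup_left).1
    have h2 := (h (v ⊔ w) w le_sup_right).2
    have h3 : 0 ≤ expect p (fun ω => (v ⊔ w) ω - v ω) :=
      expect_nonneg fun ω => sub_nonneg.2 (le_sup_left (a := v) (b := w) ω)
    have h4 : expect p (fun ω => (v ⊔ w) ω - w ω) ≤ expect p (fun ω => |v ω - w ω|) := by
      refine expect_mono fun ω _ => ?_
      rw [Pi.sup_apply, sub_le_iff_le_add]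
      refine sup_le ?_ ?_
      · linarith [le_abs_self (v ω - w ω)]
      · linarith [abs_nonneg (v ω - w ω)]
    have h5 := mul_le_mul_of_nonneg_left h4 hL
    linarith [mul_nonneg hδ h3]
  refine abs_le.2 ⟨?_, key v w⟩
  have := key w v
  simp_rw [abs_sub_comm (w _) (v _)] at this
  linarith

lemma integral_lawOf (v : Ω → ℝ) (g : ℝ → ℝ) :
    ∫ x, g x ∂(lawOf p v) = expect p (fun ω => g (v ω)) := by
  unfold lawOf expect
  rw [integral_finsetSum_measure fun _ _ =>
    (integrable_dirac (by simp)).smul_measure ENNReal.ofReal_ne_top]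
  refine Finset.sum_congr rfl fun ω _ => ?_
  rw [integral_smul_measure, integral_dirac, ENNReal.toReal_ofReal (p.2.1 ω), smul_eq_mul]

lemma lawOf_Iic (v : Ω → ℝ) (m : ℝ) : lawOf p v (Set.Iic m) = ENNReal.ofReal (cdfOf p v m) := by
  unfold lawOf cdfOf
  rw [Measure.finsetSum_apply, Finset.sum_filter,
    ENNReal.ofReal_sum_of_nonneg fun ω _ => by split_ifs; exacts [p.2.1 ω, le_rfl]]
  refine Finset.sum_congr rfl fun ω _ => ?_
  rw [Measure.smul_apply, Measure.dirac_apply' _ measurableSet_Iic]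
  by_cases h : v ω ≤ m <;> simp [h]

lemma cdfOf_nonneg (v : Ω → ℝ) (m : ℝ) : 0 ≤ cdfOf p v m :=
  Finset.sum_nonneg fun ω _ => p.2.1 ω

variable {S : Type*} [Fintype S] {q : stdSimplex ℝ S}

lemma expect_eq_of_lawOf_eq {v : Ω → ℝ} {w : S → ℝ} (h : lawOf q w = lawOf p v) (g : ℝ → ℝ) :
    expect q (fun s => g (w s)) = expect p (fun ω => g (v ω)) := by
  rw [← integral_lawOf, ← integral_lawOf, h]

lemma cdfOf_eq_of_lawOf_eq {v : Ω → ℝ} {w : S → ℝ} (h : lawOf q w = lawOf p v) (m : ℝ) :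
    cdfOf q w m = cdfOf p v m := by
  have := congrArg (fun μ : Measure ℝ => μ (Set.Iic m)) h
  simp only [lawOf_Iic] at this
  exact (ENNReal.ofReal_eq_ofReal_iff (cdfOf_nonneg _ _) (cdfOf_nonneg _ _)).1 this

lemma UBSR_eq_of_lawOf_eq (l : ℝ → ℝ) {v : Ω → ℝ} {w : S → ℝ} (h : lawOf q w = lawOf p v) :
    UBSR l q w = UBSR l p v := by
  have h' : ∀ m, expect q (fun s => l (w s - m)) = expect p (fun ω => l (v ω - m)) := fun m =>
    expect_eq_of_lawOf_eq h fun x => l (x - m)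
  unfold UBSR
  simp_rw [h']

lemma OCE_eq_of_lawOf_eq (l : ℝ → ℝ) {v : Ω → ℝ} {w : S → ℝ} (h : lawOf q w = lawOf p v) :
    OCE l q w = OCE l p v := by
  have h' : ∀ m, expect q (fun s => l (w s - m)) = expect p (fun ω => l (v ω - m)) := fun m =>
    expect_eq_of_lawOf_eq h fun x => l (x - m)
  unfold OCE
  simp_rw [h']

lemma spectralRisk_eq_of_lawOf_eq (φ : ℝ → ℝ) {v : Ω → ℝ} {w : S → ℝ}
    (h : lawOf q w = lawOf p v) : spectralRisk φ q w = spectralRisk φ p v := by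
  unfold spectralRisk quantile
  simp_rw [cdfOf_eq_of_lawOf_eq h]

/-- To bound a difference by the Wasserstein distance, it suffices to consider couplings of finite
support. -/
lemma ofReal_le_wasserstein {v w : Ω → ℝ} {r L : ℝ} (hL : 0 < L)
    (h : ∀ (S : Finset (ℝ × ℝ)) (q : stdSimplex ℝ S), lawOf q (fun s => s.1.1) = lawOf p v →
      lawOf q (fun s => s.1.2) = lawOf p w → r ≤ L * expect q (fun s => |s.1.1 - s.1.2|)) :
    ENNReal.ofReal r ≤ ENNReal.ofReal L * wasserstein (lawOf p v) (lawOf p w) := by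
  classical
  have hL0 : ENNReal.ofReal L ≠ 0 := by simpa using hL
  have hrange : ∀ u : Ω → ℝ, lawOf p u (Set.range u)ᶜ = 0 := fun u => by
    have hm : MeasurableSet (Set.range u)ᶜ := (Set.finite_range u).measurableSet.compl
    unfold lawOf
    rw [Measure.finsetSum_apply]
    refine Finset.sum_eq_zero fun ω _ => ?_
    rw [Measure.smul_apply, Measure.dirac_apply' _ hm]
    simp
  rw [mul_comm, ← ENNReal.div_le_iff_le_mul (Or.inl hL0) (Or.inl ENNReal.ofReal_ne_top)]
  refine le_iInf₂ fun ψ hψ => ?_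
  rw [ENNReal.div_le_iff_le_mul (Or.inl hL0) (Or.inl ENNReal.ofReal_ne_top), mul_comm]
  set S : Finset (ℝ × ℝ) := Finset.univ.image v ×ˢ Finset.univ.image w with hS
  -- Marginals of finite support force the coupling onto the grid of pairs of values; its atoms
  -- there are the weights `q`.
  have hae : ∀ᵐ z ∂ψ, z ∈ (S : Set (ℝ × ℝ)) := by
    have h1 : ∀ᵐ z ∂ψ, z.1 ∈ Set.range v := by
      have := hrange v
      rw [← hψ.1, Measure.map_apply measurable_fst (Set.finite_range v).measurableSet.compl] at this
      exact this
    have h2 : ∀ᵐ z ∂ψ, z.2 ∈ Set.range w := by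
      have := hrange w
      rw [← hψ.2, Measure.map_apply measurable_snd (Set.finite_range w).measurableSet.compl] at this
      exact this
    filter_upwards [h1, h2] with z hz1 hz2
    simp only [hS, Finset.coe_product, Finset.coe_image, Finset.coe_univ, Set.image_univ]
    exact ⟨hz1, hz2⟩
  have hinteg : ∀ F : ℝ × ℝ → ℝ≥0∞, ∫⁻ z, F z ∂ψ = ∑ s : S, F s.1 * ψ {s.1} := fun F => by
    rw [← Measure.restrict_eq_self_of_ae_mem hae, lintegral_finset,
      Measure.restrict_eq_self_of_ae_mem hae]
    exact (Finset.sum_coe_sort S fun s => F s * ψ {s}).symm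
  have huniv : ψ Set.univ = 1 := by
    have h1 : lawOf p v Set.univ = 1 := by
      unfold lawOf
      rw [Measure.finsetSum_apply]
      simp only [Measure.smul_apply, measure_univ, smul_eq_mul, mul_one]
      rw [← ENNReal.ofReal_sum_of_nonneg fun ω _ => p.2.1 ω, p.2.2, ENNReal.ofReal_one]
    rwa [← hψ.1, Measure.map_apply measurable_fst MeasurableSet.univ, Set.preimage_univ] at h1
  have hprob : IsProbabilityMeasure ψ := ⟨huniv⟩
  have hsum : ∑ s : S, ψ.real {s.1} = 1 := by
    have h1 := hinteg fun _ => 1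
    simp only [one_mul, lintegral_const, huniv] at h1
    have h2 := congrArg ENNReal.toReal h1
    rw [ENNReal.toReal_sum fun s _ => measure_ne_top _ _] at h2
    simpa [Measure.real] using h2.symm
  set q : stdSimplex ℝ S := ⟨fun s => ψ.real {s.1}, fun s => measureReal_nonneg, hsum⟩ with hq
  have hqs : ∀ s : S, ENNReal.ofReal (q.1 s) = ψ {s.1} := fun s =>
    ENNReal.ofReal_toReal (measure_ne_top _ _)
  have hlaw : ∀ f : ℝ × ℝ → ℝ, Measurable f → lawOf q (fun s => f s.1) = ψ.map f := fun f hf => by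
    ext A hA
    rw [Measure.map_apply hf hA, ← lintegral_indicator_one (hf hA), hinteg]
    unfold lawOf
    rw [Measure.finsetSum_apply]
    refine Finset.sum_congr rfl fun s _ => ?_
    rw [Measure.smul_apply, Measure.dirac_apply' _ hA, hqs, smul_eq_mul, mul_comm]
    rfl
  have hcost : ∫⁻ z, ENNReal.ofReal |z.1 - z.2| ∂ψ =
      ENNReal.ofReal (expect q (fun s => |s.1.1 - s.1.2|)) := by
    rw [hinteg, expect, ENNReal.ofReal_sum_of_nonneg fun s _ =>
      mul_nonneg (q.2.1 s) (abs_nonneg _)]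
    refine Finset.sum_congr rfl fun s _ => ?_
    rw [ENNReal.ofReal_mul (q.2.1 s), hqs, mul_comm]
  rw [hcost, ← ENNReal.ofReal_mul hL.le]
  exact ENNReal.ofReal_le_ofReal
    (h S q ((hlaw _ measurable_fst).trans hψ.1) ((hlaw _ measurable_snd).trans hψ.2))

end Expect

/-! ### Utility-based shortfall risk -/

section Shortfall

variable {Ω : Type*} [Fintype Ω] {l : ℝ → ℝ} {ε L : ℝ}

/-- `l` has slopes between `ε` and `L`. -/
def SlopesIn (l : ℝ → ℝ) (ε L : ℝ) : Prop :=
  ∀ x y : ℝ, y ≤ x → ε * (x - y) ≤ l x - l y ∧ l x - l y ≤ L * (x - y)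

lemma BoundedSlope.exists_slopesIn (h : BoundedSlope l) :
    ∃ ε L : ℝ, 0 < ε ∧ 0 < L ∧ SlopesIn l ε L := by
  obtain ⟨-, ε, L, hε, hL, hs⟩ := h
  refine ⟨ε, L, hε, hL, fun x y hxy => ?_⟩
  rcases hxy.eq_or_lt with rfl | hlt
  · simp
  · have := hs x y hlt.ne'
    rwa [le_div_iff₀ (sub_pos.2 hlt), div_le_iff₀ (sub_pos.2 hlt)] at this

lemma expect_loss_add_le (hs : SlopesIn l ε L) (p : stdSimplex ℝ Ω) (v : Ω → ℝ) {m m' : ℝ}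
    (h : m ≤ m') :
    expect p (fun ω => l (v ω - m')) + ε * (m' - m) ≤ expect p (fun ω => l (v ω - m)) ∧
    expect p (fun ω => l (v ω - m)) ≤ expect p (fun ω => l (v ω - m')) + L * (m' - m) := by
  rw [← expect_const p (ε * (m' - m)), ← expect_add, ← expect_const p (L * (m' - m)), ← expect_add]
  refine ⟨expect_mono fun ω _ => ?_, expect_mono fun ω _ => ?_⟩
  · have := (hs (v ω - m) (v ω - m') (by linarith)).1
    linarith
  · have := (hs (v ω - m) (v ω - m') (by linarith)).2
    linarith

/-- The expected loss is continuous in `m`, decreases with slope at least `ε`, and changes sign on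
`[-‖v‖, ‖v‖]`. Its sublevel set is therefore a closed half-line starting at its unique zero. -/
lemma UBSR_le_of_expect_le (hε : 0 < ε) (hs : SlopesIn l ε L) (hl : Continuous l) (h0 : l 0 = 0)
    (p : stdSimplex ℝ Ω) (v : Ω → ℝ) :
    expect p (fun ω => l (v ω - UBSR l p v)) = 0 ∧
      ∀ m, expect p (fun ω => l (v ω - m)) ≤ 0 → UBSR l p v ≤ m := by
  set g : ℝ → ℝ := fun m => expect p (fun ω => l (v ω - m)) with hg
  have hcont : Continuous g := by
    simp only [hg, expect]
    fun_prop
  have hsign : ∀ x, (0 ≤ x → 0 ≤ l x) ∧ (x ≤ 0 → l x ≤ 0) := fun x => by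
    refine ⟨fun hx => ?_, fun hx => ?_⟩
    · have := (hs x 0 hx).1
      rw [h0] at this
      nlinarith
    · have := (hs 0 x hx).1
      rw [h0] at this
      nlinarith
  have hv : ∀ ω, |v ω| ≤ ‖v‖ := fun ω => norm_le_pi_norm v ω
  have h1 : 0 ≤ g (-‖v‖) := expect_nonneg fun ω => (hsign _).1 (by
    linarith [neg_abs_le (v ω), hv ω])
  have h2 : g ‖v‖ ≤ 0 := by
    rw [← expect_const p 0]
    exact expect_mono fun ω _ => (hsign _).2 (by linarith [le_abs_self (v ω), hv ω])
  obtain ⟨m, -, hm⟩ := intermediate_value_Icc' (by linarith [norm_nonneg v] : -‖v‖ ≤ ‖v‖)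
    hcont.continuousOn ⟨h2, h1⟩
  have hset : {m : ℝ | g m ≤ 0} = Set.Ici m := by
    ext m'
    refine ⟨fun hm' => ?_, fun hm' => ?_⟩
    · by_contra hlt
      have hlt' : m' < m := not_le.1 hlt
      have := (expect_loss_add_le hs p v hlt'.le).1
      have hpos : 0 < ε * (m - m') := mul_pos hε (sub_pos.2 hlt')
      change g m + _ ≤ g m' at this
      have : g m' ≤ 0 := hm'
      linarith
    · have := (expect_loss_add_le hs p v (show m ≤ m' from hm')).1
      change g m' + _ ≤ g m at this
      have hpos : 0 ≤ ε * (m' - m) := mul_nonneg hε.le (sub_nonneg.2 hm')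
      change g m' ≤ 0
      linarith
  have hU : UBSR l p v = m := by
    change sInf {m : ℝ | g m ≤ 0} = m
    rw [hset, csInf_Ici]
  rw [hU]
  refine ⟨hm, fun m' hm' => ?_⟩
  have : m' ∈ {m : ℝ | g m ≤ 0} := hm'
  rwa [hset] at this

lemma le_UBSR_of_le_expect (hε : 0 < ε) (hs : SlopesIn l ε L) (hl : Continuous l) (h0 : l 0 = 0)
    (p : stdSimplex ℝ Ω) (v : Ω → ℝ) {m : ℝ} (hm : 0 ≤ expect p (fun ω => l (v ω - m))) :
    m ≤ UBSR l p v := by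
  by_contra hlt
  have hlt' : UBSR l p v < m := not_le.1 hlt
  have h1 := (UBSR_le_of_expect_le hε hs hl h0 p v).1
  have h2 := (expect_loss_add_le hs p v hlt'.le).1
  have hpos : 0 < ε * (m - UBSR l p v) := mul_pos hε (sub_pos.2 hlt')
  linarith

lemma isMonetary_UBSR (hε : 0 < ε) (hs : SlopesIn l ε L) (hl : Continuous l) (hmono : Monotone l)
    (h0 : l 0 = 0) (p : stdSimplex ℝ Ω) : IsMonetary p (UBSR l p) where
  mono v w h := by
    refine (UBSR_le_of_expect_le hε hs hl h0 p v).2 _ ?_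
    rw [← (UBSR_le_of_expect_le hε hs hl h0 p w).1]
    exact expect_mono fun ω hω => hmono (by linarith [h ω hω])
  translation v r := by
    have h := (UBSR_le_of_expect_le hε hs hl h0 p v).1
    have h' : expect p (fun ω => l (v ω + r - (UBSR l p v + r))) = 0 := by
      simpa only [add_sub_add_right_eq_sub] using h
    exact le_antisymm ((UBSR_le_of_expect_le hε hs hl h0 p _).2 _ h'.le)
      (le_UBSR_of_le_expect hε hs hl h0 p _ h'.ge)
  normalized := by
    have h' : expect p (fun ω => l ((0 : Ω → ℝ) ω - 0)) = 0 := by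
      simp [h0, expect]
    exact le_antisymm ((UBSR_le_of_expect_le hε hs hl h0 p _).2 _ h'.le)
      (le_UBSR_of_le_expect hε hs hl h0 p _ h'.ge)

/-- Both expected losses vanish, so the loss gained by raising `w` to `v` balances the loss removed
by raising the shift. Each is its increment times a slope in `[ε, L]`, which explains the ratios. -/
lemma hasSlopes_UBSR (hε : 0 < ε) (hL : 0 < L) (hs : SlopesIn l ε L) (hl : Continuous l)
    (hmono : Monotone l) (h0 : l 0 = 0) (p : stdSimplex ℝ Ω) :
    HasSlopes p (UBSR l p) (ε / L) (L / ε) := by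
  intro v w hwv
  have hle : UBSR l p w ≤ UBSR l p v :=
    (isMonetary_UBSR hε hs hl hmono h0 p).mono w v fun ω _ => hwv ω
  have hv := (UBSR_le_of_expect_le hε hs hl h0 p v).1
  have hw := (UBSR_le_of_expect_le hε hs hl h0 p w).1
  have hshift := expect_loss_add_le hs p w hle
  have h1 : expect p (fun ω => l (w ω - UBSR l p v)) + ε * expect p (fun ω => v ω - w ω) ≤
      expect p (fun ω => l (v ω - UBSR l p v)) := by
    rw [← expect_const_mul, ← expect_add]
    refine expect_mono fun ω _ => ?_
    have := (hs (v ω - UBSR l p v) (w ω - UBSR l p v) (by linarith [hwv ω])).1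
    linarith
  have h2 : expect p (fun ω => l (v ω - UBSR l p v)) ≤
      expect p (fun ω => l (w ω - UBSR l p v)) + L * expect p (fun ω => v ω - w ω) := by
    rw [← expect_const_mul, ← expect_add]
    refine expect_mono fun ω _ => ?_
    have := (hs (v ω - UBSR l p v) (w ω - UBSR l p v) (by linarith [hwv ω])).2
    linarith
  constructor
  · rw [div_mul_eq_mul_div, div_le_iff₀ hL]
    linarith
  · rw [div_mul_eq_mul_div, le_div_iff₀ hε]
    linarith

lemma UBSR_convex (hε : 0 < ε) (hs : SlopesIn l ε L) (hl : Continuous l)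
    (hconv : ConvexOn ℝ Set.univ l) (h0 : l 0 = 0) (p : stdSimplex ℝ Ω) (t : ℝ) (v w : Ω → ℝ)
    (ht0 : 0 ≤ t) (ht1 : t ≤ 1) :
    UBSR l p (t • v + (1 - t) • w) ≤ t * UBSR l p v + (1 - t) * UBSR l p w := by
  refine (UBSR_le_of_expect_le hε hs hl h0 p _).2 _ ?_
  have hv := (UBSR_le_of_expect_le hε hs hl h0 p v).1
  have hw := (UBSR_le_of_expect_le hε hs hl h0 p w).1
  have : (0 : ℝ) = t * expect p (fun ω => l (v ω - UBSR l p v)) +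
      (1 - t) * expect p (fun ω => l (w ω - UBSR l p w)) := by rw [hv, hw]; ring
  rw [this, ← expect_const_mul, ← expect_const_mul, ← expect_add]
  refine expect_mono fun ω _ => ?_
  have := hconv.2 (Set.mem_univ (v ω - UBSR l p v)) (Set.mem_univ (w ω - UBSR l p w)) ht0
    (sub_nonneg.2 ht1) (by ring)
  simp only [smul_eq_mul] at this
  refine le_trans (le_of_eq ?_) this
  congr 1
  simp only [Pi.add_apply, Pi.smul_apply, smul_eq_mul]
  ring

end Shortfall

/-! ### Optimized certainty equivalents -/

section CertaintyEquivalent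

variable {Ω : Type*} [Fintype Ω] {l : ℝ → ℝ} {ε L : ℝ}

/-- The subgradient condition says `l y ≥ y`. -/
lemma bddBelow_OCE (hl : IsOCELoss l) (p : stdSimplex ℝ Ω) (v : Ω → ℝ) :
    expect p v ∈ lowerBounds (Set.range fun ξ : ℝ => ξ + expect p (fun ω => l (v ω - ξ))) := by
  rintro _ ⟨ξ, rfl⟩
  have : expect p (fun ω => v ω - ξ) ≤ expect p (fun ω => l (v ω - ξ)) :=
    expect_mono fun ω _ => by
      have := hl.subgradient (v ω - ξ)
      rw [hl.zero] at this
      linarith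
  rw [expect_sub, expect_const] at this
  dsimp only
  linarith

lemma OCE_le (hl : IsOCELoss l) (p : stdSimplex ℝ Ω) (v : Ω → ℝ) (ξ : ℝ) :
    OCE l p v ≤ ξ + expect p (fun ω => l (v ω - ξ)) :=
  ciInf_le ⟨_, bddBelow_OCE hl p v⟩ ξ

lemma isMonetary_OCE (hl : IsOCELoss l) (p : stdSimplex ℝ Ω) : IsMonetary p (OCE l p) where
  mono v w h := le_ciInf fun ξ => (OCE_le hl p v ξ).trans <|
    add_le_add_right (expect_mono fun ω hω => hl.monotone (by linarith [h ω hω])) ξ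
  translation v r := by
    refine le_antisymm ?_ (le_ciInf fun ξ => ?_)
    · rw [← sub_le_iff_le_add]
      refine le_ciInf fun ξ => ?_
      have := OCE_le hl p (fun ω => v ω + r) (ξ + r)
      simp only [add_sub_add_right_eq_sub] at this
      linarith
    · have := OCE_le hl p v (ξ - r)
      simp only [sub_sub_eq_add_sub] at this
      linarith
  normalized := by
    refine le_antisymm ?_ (le_ciInf fun ξ => ?_)
    · refine (OCE_le hl p 0 0).trans ?_
      simp [hl.zero, expect]
    · refine le_trans ?_ (bddBelow_OCE hl p 0 ⟨ξ, rfl⟩)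
      simp [expect]

/-- For each fixed `ξ` the objective has these slopes, and they survive the infimum over `ξ`. -/
lemma hasSlopes_OCE (hs : SlopesIn l ε L) (hl : IsOCELoss l) (p : stdSimplex ℝ Ω) :
    HasSlopes p (OCE l p) ε L := by
  intro v w hwv
  constructor
  · rw [le_sub_iff_add_le]
    refine le_ciInf fun ξ => ?_
    refine le_trans (add_le_add_right (OCE_le hl p w ξ) _) ?_
    rw [add_left_comm, ← expect_const_mul, ← expect_add]
    refine add_le_add_right (expect_mono fun ω _ => ?_) ξ
    have := (hs (v ω - ξ) (w ω - ξ) (by linarith [hwv ω])).1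
    linarith
  · rw [sub_le_comm]
    refine le_ciInf fun ξ => ?_
    rw [sub_le_iff_le_add]
    refine (OCE_le hl p v ξ).trans ?_
    rw [add_assoc, ← expect_const_mul, ← expect_add]
    refine add_le_add_right (expect_mono fun ω _ => ?_) ξ
    have := (hs (v ω - ξ) (w ω - ξ) (by linarith [hwv ω])).2
    linarith

/-- The objective is jointly convex in `(v, ξ)`, and partial minimization preserves convexity. -/
lemma OCE_convex (hl : IsOCELoss l) (p : stdSimplex ℝ Ω) (t : ℝ) (v w : Ω → ℝ)
    (ht0 : 0 ≤ t) (ht1 : t ≤ 1) :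
    OCE l p (t • v + (1 - t) • w) ≤ t * OCE l p v + (1 - t) * OCE l p w := by
  refine le_of_forall_pos_le_add fun r hr => ?_
  obtain ⟨ξ, hξ⟩ := exists_lt_of_ciInf_lt (show OCE l p v < OCE l p v + r by linarith)
  obtain ⟨ζ, hζ⟩ := exists_lt_of_ciInf_lt (show OCE l p w < OCE l p w + r by linarith)
  have h1 := OCE_le hl p (t • v + (1 - t) • w) (t * ξ + (1 - t) * ζ)
  have h2 : expect p (fun ω => l ((t • v + (1 - t) • w) ω - (t * ξ + (1 - t) * ζ))) ≤
      t * expect p (fun ω => l (v ω - ξ)) + (1 - t) * expect p (fun ω => l (w ω - ζ)) := by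
    rw [← expect_const_mul, ← expect_const_mul, ← expect_add]
    refine expect_mono fun ω _ => ?_
    have := hl.convex.2 (Set.mem_univ (v ω - ξ)) (Set.mem_univ (w ω - ζ)) ht0
      (sub_nonneg.2 ht1) (by ring)
    simp only [smul_eq_mul] at this
    refine le_trans (le_of_eq ?_) this
    congr 1
    simp only [Pi.add_apply, Pi.smul_apply, smul_eq_mul]
    ring
  have h3 := mul_le_mul_of_nonneg_left hξ.le ht0
  have h4 := mul_le_mul_of_nonneg_left hζ.le (sub_nonneg.2 ht1)
  linarith

end CertaintyEquivalent

/-! ### Spectral risk measures -/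

section Spectral

variable {Ω : Type*} [Fintype Ω] {p : stdSimplex ℝ Ω}

lemma cdfOf_mono (v : Ω → ℝ) : Monotone (cdfOf p v) := fun _ _ h =>
  Finset.sum_le_sum_of_subset_of_nonneg
    (Finset.monotone_filter_right _ fun _ _ hω => le_trans hω h) fun ω _ _ => p.2.1 ω

lemma cdfOf_le_one (v : Ω → ℝ) (m : ℝ) : cdfOf p v m ≤ 1 := by
  rw [← p.2.2]
  exact Finset.sum_le_sum_of_subset_of_nonneg (Finset.filter_subset _ _) fun ω _ _ => p.2.1 ω

lemma cdfOf_anti {v w : Ω → ℝ} (h : ∀ ω, 0 < p.1 ω → v ω ≤ w ω) (m : ℝ) :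
    cdfOf p w m ≤ cdfOf p v m := by
  unfold cdfOf
  rw [Finset.sum_filter, Finset.sum_filter]
  refine Finset.sum_le_sum fun ω _ => ?_
  rcases (p.2.1 ω).eq_or_lt with h0 | h0
  · simp [← h0]
  · by_cases hw : w ω ≤ m
    · simp [hw, (h ω h0).trans hw]
    · simp only [hw, if_false]
      split_ifs
      exacts [h0.le, le_rfl]

/-- The distribution function jumps only at values of `v`, so the infimum is attained at one. At `β
= 0` the level set would be all of `ℝ`. -/
lemma exists_isLeast_quantile (v : Ω → ℝ) {β : ℝ} (hβ : β ∈ Set.Ioc (0 : ℝ) 1) :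
    ∃ ω, quantile p v β = v ω ∧ IsLeast {m : ℝ | β ≤ cdfOf p v m} (v ω) := by
  classical
  have hlast : ∀ m, β ≤ cdfOf p v m → ∃ ω, v ω ≤ m ∧ cdfOf p v m ≤ cdfOf p v (v ω) := by
    intro m hm
    have hne : (Finset.univ.filter fun ω => v ω ≤ m).Nonempty := by
      by_contra hne
      rw [Finset.not_nonempty_iff_eq_empty] at hne
      rw [cdfOf, hne, Finset.sum_empty] at hm
      exact absurd hβ.1 (not_lt.2 hm)
    obtain ⟨ω, hω, hmax⟩ := Finset.exists_max_image _ v hne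
    refine ⟨ω, (Finset.mem_filter.1 hω).2, ?_⟩
    exact Finset.sum_le_sum_of_subset_of_nonneg (fun ω' hω' =>
      Finset.mem_filter.2 ⟨Finset.mem_univ _, hmax ω' hω'⟩) fun ω _ _ => p.2.1 ω
  have htop : β ≤ cdfOf p v ‖v‖ := by
    have : cdfOf p v ‖v‖ = 1 := by
      rw [← p.2.2, cdfOf, Finset.filter_true_of_mem]
      exact fun ω _ => (le_abs_self _).trans (norm_le_pi_norm v ω)
    rw [this]
    exact hβ.2
  have hne : (Finset.univ.filter fun ω => β ≤ cdfOf p v (v ω)).Nonempty := by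
    obtain ⟨ω, -, h⟩ := hlast _ htop
    exact ⟨ω, Finset.mem_filter.2 ⟨Finset.mem_univ _, htop.trans h⟩⟩
  obtain ⟨ω, hω, hmin⟩ := Finset.exists_min_image _ v hne
  have hleast : IsLeast {m : ℝ | β ≤ cdfOf p v m} (v ω) := by
    refine ⟨(Finset.mem_filter.1 hω).2, fun m hm => ?_⟩
    obtain ⟨ω', h1, h2⟩ := hlast m hm
    exact (hmin ω' (Finset.mem_filter.2 ⟨Finset.mem_univ _, le_trans hm h2⟩)).trans h1
  exact ⟨ω, hleast.csInf_eq, hleast⟩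

/-- This Galois connection yields monotonicity, equivariance and measurability of quantiles. -/
lemma quantile_le_iff (v : Ω → ℝ) {β : ℝ} (hβ : β ∈ Set.Ioc (0 : ℝ) 1) (m : ℝ) :
    quantile p v β ≤ m ↔ β ≤ cdfOf p v m := by
  obtain ⟨ω, h1, h2⟩ := exists_isLeast_quantile (p := p) v hβ
  rw [h1]
  exact ⟨fun h => le_trans h2.1 (cdfOf_mono v h), fun h => h2.2 h⟩

lemma abs_quantile_le (v : Ω → ℝ) {β : ℝ} (hβ : β ∈ Set.Ioc (0 : ℝ) 1) :
    |quantile p v β| ≤ ‖v‖ := by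
  obtain ⟨ω, h1, -⟩ := exists_isLeast_quantile (p := p) v hβ
  rw [h1]
  exact norm_le_pi_norm v ω

lemma quantile_mono {v w : Ω → ℝ} (h : ∀ ω, 0 < p.1 ω → v ω ≤ w ω) {β : ℝ}
    (hβ : β ∈ Set.Ioc (0 : ℝ) 1) : quantile p v β ≤ quantile p w β := by
  rw [quantile_le_iff v hβ]
  exact ((quantile_le_iff w hβ _).1 le_rfl).trans (cdfOf_anti h _)

lemma quantile_add_const (v : Ω → ℝ) (r : ℝ) {β : ℝ} (hβ : β ∈ Set.Ioc (0 : ℝ) 1) :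
    quantile p (fun ω => v ω + r) β = quantile p v β + r := by
  refine eq_of_forall_ge_iff fun m => ?_
  rw [quantile_le_iff _ hβ, ← le_sub_iff_add_le, quantile_le_iff _ hβ]
  simp only [cdfOf, le_sub_iff_add_le]

lemma quantile_smul (v : Ω → ℝ) {r : ℝ} (hr : 0 < r) {β : ℝ} (hβ : β ∈ Set.Ioc (0 : ℝ) 1) :
    quantile p (r • v) β = r * quantile p v β := by
  refine eq_of_forall_ge_iff fun m => ?_
  rw [quantile_le_iff _ hβ, ← le_div_iff₀' hr, quantile_le_iff _ hβ]
  simp only [cdfOf, le_div_iff₀' hr, Pi.smul_apply, smul_eq_mul]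

lemma quantile_zero {β : ℝ} (hβ : β ∈ Set.Ioc (0 : ℝ) 1) : quantile p 0 β = 0 := by
  have := abs_quantile_le (p := p) 0 hβ
  rwa [norm_zero, abs_nonpos_iff] at this

lemma aemeasurable_quantile (v : Ω → ℝ) :
    AEMeasurable (quantile p v) (volume.restrict (Set.Ioc (0 : ℝ) 1)) := by
  refine aemeasurable_restrict_of_monotoneOn measurableSet_Ioc fun β hβ β' hβ' h => ?_
  rw [quantile_le_iff v hβ]
  exact h.trans ((quantile_le_iff v hβ' _).1 le_rfl)

/-- Inverse transform sampling: up to level `m`, the quantile function lives on `(0, F m]`. -/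
lemma map_quantile (v : Ω → ℝ) :
    (volume.restrict (Set.Ioc (0 : ℝ) 1)).map (quantile p v) = lawOf p v := by
  have hfin : IsFiniteMeasure ((volume.restrict (Set.Ioc (0 : ℝ) 1)).map (quantile p v)) :=
    inferInstance
  refine Measure.ext_of_Iic _ _ fun m => ?_
  rw [Measure.map_apply_of_aemeasurable (aemeasurable_quantile v) measurableSet_Iic,
    Measure.restrict_apply' measurableSet_Ioc, lawOf_Iic]
  have : quantile p v ⁻¹' Set.Iic m ∩ Set.Ioc 0 1 = Set.Ioc 0 (cdfOf p v m) := by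
    ext β
    constructor
    · rintro ⟨h1, h2⟩
      exact ⟨h2.1, (quantile_le_iff v h2 m).1 h1⟩
    · rintro ⟨h1, h2⟩
      have hβ : β ∈ Set.Ioc (0 : ℝ) 1 := ⟨h1, h2.trans (cdfOf_le_one v m)⟩
      exact ⟨(quantile_le_iff v hβ m).2 h2, hβ⟩
  rw [this, Real.volume_Ioc, sub_zero]

lemma integral_quantile (v : Ω → ℝ) : ∫ β in Set.Ioc (0 : ℝ) 1, quantile p v β = expect p v := by
  have h := integral_lawOf (p := p) v fun x => x
  rw [← h, ← map_quantile]
  exact (integral_map (aemeasurable_quantile v) measurable_id.aestronglyMeasurable).symm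

lemma integrableOn_quantile (v : Ω → ℝ) : IntegrableOn (quantile p v) (Set.Ioc (0 : ℝ) 1) := by
  refine Integrable.of_bound (aemeasurable_quantile v).aestronglyMeasurable ‖v‖ ?_
  filter_upwards [ae_restrict_mem measurableSet_Ioc] with β hβ
  exact abs_quantile_le v hβ

variable {φ : ℝ → ℝ}

lemma IsSpectrum.integrableOn (hφ : IsSpectrum φ) : IntegrableOn φ (Set.Ioc (0 : ℝ) 1) := by
  have h := hφ.integral_eq_one
  rw [intervalIntegral.integral_of_le zero_le_one] at h
  by_contra hn
  rw [integral_undef hn] at h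
  exact zero_ne_one h

lemma IsSpectrum.setIntegral_eq_one (hφ : IsSpectrum φ) : ∫ β in Set.Ioc (0 : ℝ) 1, φ β = 1 := by
  rw [← intervalIntegral.integral_of_le zero_le_one, hφ.integral_eq_one]

lemma IsSpectrum.integrableOn_mul (hφ : IsSpectrum φ) (v : Ω → ℝ) :
    IntegrableOn (fun β => φ β * quantile p v β) (Set.Ioc (0 : ℝ) 1) := by
  refine hφ.integrableOn.mul_bdd (c := ‖v‖) (aemeasurable_quantile v).aestronglyMeasurable ?_
  filter_upwards [ae_restrict_mem measurableSet_Ioc] with β hβ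
  exact abs_quantile_le v hβ

lemma spectralRisk_eq (φ : ℝ → ℝ) (p : stdSimplex ℝ Ω) (v : Ω → ℝ) :
    spectralRisk φ p v = ∫ β in Set.Ioc (0 : ℝ) 1, φ β * quantile p v β :=
  intervalIntegral.integral_of_le zero_le_one

lemma isMonetary_spectralRisk (hφ : IsSpectrum φ) (p : stdSimplex ℝ Ω) :
    IsMonetary p (spectralRisk φ p) where
  mono v w h := by
    rw [spectralRisk_eq, spectralRisk_eq]
    refine setIntegral_mono_on (hφ.integrableOn_mul v) (hφ.integrableOn_mul w) measurableSet_Ioc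
      fun β hβ => ?_
    exact mul_le_mul_of_nonneg_left (quantile_mono h hβ) (hφ.nonneg β (Set.Ioc_subset_Icc_self hβ))
  translation v r := by
    rw [spectralRisk_eq, spectralRisk_eq]
    have h1 : ∫ β in Set.Ioc (0 : ℝ) 1, φ β * quantile p (fun ω => v ω + r) β =
        ∫ β in Set.Ioc (0 : ℝ) 1, (φ β * quantile p v β + φ β * r) :=
      setIntegral_congr_fun measurableSet_Ioc fun β hβ => by
        rw [quantile_add_const v r hβ, mul_add]
    rw [h1, integral_add (hφ.integrableOn_mul v) (hφ.integrableOn.mul_const r),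
      integral_mul_const, hφ.setIntegral_eq_one, one_mul]
  normalized := by
    rw [spectralRisk_eq]
    refine (setIntegral_congr_fun measurableSet_Ioc fun β hβ => ?_).trans (integral_zero _ _)
    rw [quantile_zero hβ, mul_zero]

/-- For `w ≤ v` the difference of quantile functions is nonnegative and integrates to `E[v - w]`;
weighting it by `φ ∈ [ε, L]` gives both bounds. -/
lemma hasSlopes_spectralRisk (hφ : IsSpectrum φ) {ε L : ℝ}
    (hb : ∀ β ∈ Set.Icc (0 : ℝ) 1, ε ≤ φ β ∧ φ β ≤ L) (p : stdSimplex ℝ Ω) :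
    HasSlopes p (spectralRisk φ p) ε L := by
  intro v w hwv
  have hE : expect p (fun ω => v ω - w ω) =
      ∫ β in Set.Ioc (0 : ℝ) 1, (quantile p v β - quantile p w β) := by
    rw [expect_sub, ← integral_quantile, ← integral_quantile,
      integral_sub (integrableOn_quantile v) (integrableOn_quantile w)]
  have hR : spectralRisk φ p v - spectralRisk φ p w =
      ∫ β in Set.Ioc (0 : ℝ) 1, (φ β * quantile p v β - φ β * quantile p w β) := by
    rw [spectralRisk_eq, spectralRisk_eq,
      integral_sub (hφ.integrableOn_mul v) (hφ.integrableOn_mul w)]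
  have hi := (hφ.integrableOn_mul (p := p) v).sub (hφ.integrableOn_mul (p := p) w)
  have hq := (integrableOn_quantile (p := p) v).sub (integrableOn_quantile (p := p) w)
  have hpos : ∀ β ∈ Set.Ioc (0 : ℝ) 1, 0 ≤ quantile p v β - quantile p w β := fun β hβ =>
    sub_nonneg.2 (quantile_mono (fun ω _ => hwv ω) hβ)
  rw [hE, hR, ← integral_const_mul, ← integral_const_mul]
  refine ⟨setIntegral_mono_on (hq.const_mul ε) hi measurableSet_Ioc fun β hβ => ?_,
    setIntegral_mono_on hi (hq.const_mul L) measurableSet_Ioc fun β hβ => ?_⟩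
  · rw [← mul_sub]
    exact mul_le_mul_of_nonneg_right (hb β (Set.Ioc_subset_Icc_self hβ)).1 (hpos β hβ)
  · rw [← mul_sub]
    exact mul_le_mul_of_nonneg_right (hb β (Set.Ioc_subset_Icc_self hβ)).2 (hpos β hβ)

lemma spectralRisk_smul (φ : ℝ → ℝ) (p : stdSimplex ℝ Ω) {r : ℝ} (hr : 0 < r) (v : Ω → ℝ) :
    spectralRisk φ p (r • v) = r * spectralRisk φ p v := by
  rw [spectralRisk_eq, spectralRisk_eq, ← integral_const_mul]
  refine setIntegral_congr_fun measurableSet_Ioc fun β hβ => ?_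
  rw [quantile_smul v hr hβ]
  ring

end Spectral

/-! ### Monetary risk measures: Lipschitz continuity and asymptotics -/

section Monetary

variable {Ω : Type*} [Fintype Ω] {p : stdSimplex ℝ Ω} {ρ : (Ω → ℝ) → ℝ}

lemma IsMonetary.le_add (h : IsMonetary p ρ) {v w : Ω → ℝ} {r : ℝ} (hvw : ∀ ω, v ω ≤ w ω + r) :
    ρ v ≤ ρ w + r := by
  rw [← h.translation]
  exact h.mono _ _ fun ω _ => hvw ω

lemma IsMonetary.le_of_le_const (h : IsMonetary p ρ) {v : Ω → ℝ} {r : ℝ} (hv : ∀ ω, v ω ≤ r) :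
    ρ v ≤ r := by
  have := h.le_add (w := 0) (r := r) (v := v) (by simpa using hv)
  rwa [h.normalized, zero_add] at this

lemma IsMonetary.abs_sub_le (h : IsMonetary p ρ) (v w : Ω → ℝ) : |ρ v - ρ w| ≤ ‖v - w‖ := by
  have hb : ∀ ω, |v ω - w ω| ≤ ‖v - w‖ := fun ω => norm_le_pi_norm (v - w) ω
  refine abs_le.2 ⟨?_, ?_⟩
  · have := h.le_add (v := w) (w := v) (r := ‖v - w‖) fun ω => by
      linarith [(abs_le.1 (hb ω)).1]
    linarith
  · have := h.le_add (v := v) (w := w) (r := ‖v - w‖) fun ω => by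
      linarith [(abs_le.1 (hb ω)).2]
    linarith

lemma IsMonetary.abs_scaled_sub_le (h : IsMonetary p ρ) {s : ℝ} (hs : 0 < s) (v w : Ω → ℝ) :
    |1 / s * ρ (s • v) - 1 / s * ρ (s • w)| ≤ ‖v - w‖ := by
  have h1 := h.abs_sub_le (s • v) (s • w)
  rw [← smul_sub, norm_smul, Real.norm_of_nonneg hs.le] at h1
  rw [← mul_sub, abs_mul, abs_of_pos (by positivity : 0 < 1 / s), one_div_mul_eq_div,
    div_le_iff₀ hs]
  linarith

/-- The rescaled values of a convex monetary risk measure converge. -/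
lemma IsMonetary.exists_tendsto_of_convex (h : IsMonetary p ρ)
    (hconv : ∀ (t : ℝ) (v w : Ω → ℝ), 0 ≤ t → t ≤ 1 →
      ρ (t • v + (1 - t) • w) ≤ t * ρ v + (1 - t) * ρ w) (v : Ω → ℝ) :
    ∃ l, Tendsto (fun s : ℝ => 1 / s * ρ (s • v)) atTop (𝓝 l) := by
  set F : ℝ → ℝ := fun s => 1 / s * ρ (s • v) with hF
  -- Convexity and `ρ 0 = 0` make the difference quotients from the origin nondecreasing along the
  -- ray.
  have hmono : ∀ s s', 0 < s → s ≤ s' → F s ≤ F s' := fun s s' hs hss => by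
    have hs' : 0 < s' := hs.trans_le hss
    have h1 := hconv (s / s') (s' • v) 0 (by positivity) ((div_le_one hs').2 hss)
    rw [smul_zero, add_zero, smul_smul, div_mul_cancel₀ _ hs'.ne', h.normalized, mul_zero,
      add_zero] at h1
    simp only [hF]
    calc 1 / s * ρ (s • v) ≤ 1 / s * (s / s' * ρ (s' • v)) := by gcongr
      _ = _ := by field_simp
  have hbd : ∀ s, 0 < s → F s ≤ ‖v‖ := fun s hs => by
    have := h.abs_scaled_sub_le hs v 0
    rw [smul_zero, h.normalized, mul_zero, sub_zero, sub_zero] at this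
    exact (le_abs_self _).trans this
  have hG : Monotone fun s => F (max s 1) := fun s s' hss =>
    hmono _ _ (by positivity) (max_le_max_right 1 hss)
  refine ⟨_, (tendsto_atTop_ciSup hG ⟨‖v‖, ?_⟩).congr' ?_⟩
  · rintro _ ⟨s, rfl⟩
    exact hbd _ (by positivity)
  · filter_upwards [eventually_ge_atTop 1] with s hs
    rw [max_eq_left hs]

end Monetary

/-! ### Asymptotic coherence and the Doeblin condition -/

section Model

variable {X A : Type*} [Fintype X] {M : MDP X A} {R : X → A → (X → ℝ) → ℝ}

/-- The rescaled maps are 1-Lipschitz uniformly in `s`, so pointwise convergence is locally uniform,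
and the axioms of a risk measure pass to the limit. -/
lemma asymptoticallyCoherent_of_tendsto (hR : IsRiskMap M R)
    (hlim : ∀ x a v, ∃ l, Tendsto (fun s : ℝ => 1 / s * R x a (s • v)) atTop (𝓝 l)) :
    AsymptoticallyCoherent M R := by
  choose Rinf hRinf using hlim
  have hlip : ∀ x a v w, |Rinf x a v - Rinf x a w| ≤ ‖v - w‖ := fun x a v w => by
    refine le_of_tendsto ((hRinf x a v).sub (hRinf x a w)).abs ?_
    filter_upwards [eventually_gt_atTop 0] with s hs
    exact (hR x a).abs_scaled_sub_le hs v w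
  refine ⟨Rinf, fun x a => ⟨fun v w h => ?_, fun v r => ?_, ?_⟩, fun x a =>
    ⟨hRinf x a, fun C hC => ?_⟩⟩
  · refine le_of_tendsto_of_tendsto (hRinf x a v) (hRinf x a w) ?_
    filter_upwards [eventually_gt_atTop 0] with s hs
    refine mul_le_mul_of_nonneg_left ((hR x a).mono _ _ fun y hy => ?_) (by positivity)
    exact mul_le_mul_of_nonneg_left (h y hy) hs.le
  · refine tendsto_nhds_unique (hRinf x a _) (((hRinf x a v).add_const r).congr' ?_)
    filter_upwards [eventually_gt_atTop 0] with s hs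
    have : s • (fun y => v y + r) = fun y => (s • v) y + s * r := by
      ext y; simp [mul_add]
    rw [this, (hR x a).translation]
    field_simp
  · refine tendsto_nhds_unique (hRinf x a 0) (tendsto_const_nhds.congr fun s => ?_)
    rw [smul_zero, (hR x a).normalized, mul_zero]
  · rw [← tendstoLocallyUniformlyOn_iff_tendstoUniformlyOn_of_compact hC,
      Metric.tendstoLocallyUniformlyOn_iff]
    intro ε hε v _
    refine ⟨Metric.ball v (ε / 3), mem_nhdsWithin_of_mem_nhds (Metric.ball_mem_nhds v (by linarith)),
      ?_⟩
    filter_upwards [eventually_gt_atTop 0,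
      Metric.tendsto_nhds.1 (hRinf x a v) (ε / 3) (by linarith)] with s hs hsv w hw
    rw [Metric.mem_ball, dist_eq_norm] at hw
    have h1 := (hlip x a w v).trans_lt hw
    have h2 := ((hR x a).abs_scaled_sub_le hs w v).trans_lt hw
    rw [Real.dist_eq] at hsv ⊢
    rw [abs_lt] at *
    constructor <;> linarith

/-- The action of `R` dominates a multiple of the evaluation at `y`. -/
def Minorized (R : X → A → (X → ℝ) → ℝ) (y : X) (α : ℝ) : Prop :=
  ∀ x a (v w : X → ℝ), w ≤ v → α * (v y - w y) ≤ R x a v - R x a w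

lemma exists_minorized [Fintype A] [Nonempty X] [Nonempty A] {y : X} (hy : ∀ x a, 0 < (M.P x a).1 y) {δ L : ℝ}
    (hδ : 0 < δ) (hs : ∀ x a, HasSlopes (M.P x a) (R x a) δ L) :
    ∃ α, 0 < α ∧ α < 1 ∧ Minorized R y α := by
  obtain ⟨⟨x₀, a₀⟩, hmin⟩ := Finite.exists_min fun k : X × A => (M.P k.1 k.2).1 y
  have hpos := hy x₀ a₀
  -- The minimum with `1 / 2` only ensures `α < 1`.
  refine ⟨min (1 / 2) (δ * (M.P x₀ a₀).1 y), by positivity,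
    (min_le_left _ _).trans_lt (by norm_num), fun x a v w hwv => ?_⟩
  have hyv : 0 ≤ v y - w y := sub_nonneg.2 (hwv y)
  have h1 : (M.P x a).1 y * (v y - w y) ≤ expect (M.P x a) (fun ω => v ω - w ω) :=
    Finset.single_le_sum (f := fun ω => (M.P x a).1 ω * (v ω - w ω))
      (fun ω _ => mul_nonneg ((M.P x a).2.1 ω) (sub_nonneg.2 (hwv ω))) (Finset.mem_univ y)
  have h2 : (M.P x₀ a₀).1 y * (v y - w y) ≤ (M.P x a).1 y * (v y - w y) :=
    mul_le_mul_of_nonneg_right (hmin (x, a)) hyv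
  calc min (1 / 2) (δ * (M.P x₀ a₀).1 y) * (v y - w y)
      ≤ δ * (M.P x₀ a₀).1 y * (v y - w y) := mul_le_mul_of_nonneg_right (min_le_right _ _) hyv
    _ = δ * ((M.P x₀ a₀).1 y * (v y - w y)) := by ring
    _ ≤ δ * expect (M.P x a) (fun ω => v ω - w ω) :=
        mul_le_mul_of_nonneg_left (h2.trans h1) hδ.le
    _ ≤ _ := (hs x a v w hwv).1

lemma doeblin_of_minorized {y : X} {α : ℝ} (hα0 : 0 < α) (hα1 : α < 1) (h : Minorized R y α) :
    Doeblin R := by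
  classical
  refine ⟨⟨Pi.single y 1, single_mem_stdSimplex ℝ y⟩, fun v => v y, ⟨⟨?_, ?_, ?_⟩, ?_, ?_⟩, α, hα0,
    hα1, fun v v' hv x a => ?_⟩
  · exact fun v w hvw => hvw y (by simp)
  · exact fun v r => rfl
  · rfl
  · exact fun t v w _ _ => le_rfl
  · exact fun r v _ => rfl
  · linarith [h x a v v' hv]

end Model

/-! ### The Bellman operator -/

section Spread

variable {K : Type*} [Fintype K]

/-- The oscillation `max e - min e`. -/
noncomputable def spread (e : K → ℝ) : ℝ := ‖fun ij : K × K => e ij.1 - e ij.2‖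

lemma spread_nonneg (e : K → ℝ) : 0 ≤ spread e := norm_nonneg _

lemma sub_le_spread (e : K → ℝ) (i j : K) : e i - e j ≤ spread e :=
  (le_abs_self _).trans (norm_le_pi_norm (fun ij : K × K => e ij.1 - e ij.2) (i, j))

lemma spread_le {e : K → ℝ} {r : ℝ} (hr : 0 ≤ r) (h : ∀ i j, e i - e j ≤ r) : spread e ≤ r := by
  refine (pi_norm_le_iff_of_nonneg hr).2 fun ij => ?_
  rw [Real.norm_eq_abs, abs_le]
  constructor <;> linarith [h ij.1 ij.2, h ij.2 ij.1]

/-- The norm `|e k₀| + c (max e - min e)`. -/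
noncomputable def spreadNorm (k₀ : K) (c : ℝ) (hc : 0 ≤ c) : Seminorm ℝ (K → ℝ) :=
  Seminorm.of (fun e => |e k₀| + c * spread e)
    (fun e e' => by
      have h1 : spread (e + e') ≤ spread e + spread e' :=
        spread_le (add_nonneg (spread_nonneg _) (spread_nonneg _)) fun i j => by
          have := sub_le_spread e i j
          have := sub_le_spread e' i j
          simp only [Pi.add_apply]
          linarith
      have h2 : |(e + e') k₀| ≤ |e k₀| + |e' k₀| := abs_add_le _ _
      have := mul_le_mul_of_nonneg_left h1 hc
      linarith)
    (fun r e => by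
      have h1 : spread (r • e) = |r| * spread e := by
        rw [spread, spread, ← Real.norm_eq_abs, ← norm_smul]
        congr 1
        ext ij
        simp [mul_sub]
      rw [h1, Pi.smul_apply, smul_eq_mul, abs_mul, Real.norm_eq_abs]
      ring)

lemma spreadNorm_apply (k₀ : K) (c : ℝ) (hc : 0 ≤ c) (e : K → ℝ) :
    spreadNorm k₀ c hc e = |e k₀| + c * spread e := rfl

lemma norm_le_spreadNorm (k₀ : K) {c : ℝ} (hc : 1 ≤ c) (e : K → ℝ) :
    ‖e‖ ≤ spreadNorm k₀ c (zero_le_one.trans hc) e := by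
  refine (pi_norm_le_iff_of_nonneg (apply_nonneg _ _)).2 fun k => ?_
  have h1 := sub_le_spread e k k₀
  have h2 := sub_le_spread e k₀ k
  have h3 : 1 * spread e ≤ c * spread e := mul_le_mul_of_nonneg_right hc (spread_nonneg e)
  rw [spreadNorm_apply, Real.norm_eq_abs, abs_le]
  constructor <;> linarith [le_abs_self (e k₀), neg_abs_le (e k₀)]

lemma spreadNorm_le (k₀ : K) {c : ℝ} (hc : 0 ≤ c) (e : K → ℝ) :
    spreadNorm k₀ c hc e ≤ (1 + 2 * c) * ‖e‖ := by
  have hb : ∀ k, |e k| ≤ ‖e‖ := fun k => norm_le_pi_norm e k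
  have h1 : spread e ≤ 2 * ‖e‖ := spread_le (by positivity) fun i j => by
    linarith [(abs_le.1 (hb i)).2, (abs_le.1 (hb j)).1]
  have h2 := mul_le_mul_of_nonneg_left h1 hc
  rw [spreadNorm_apply]
  linarith [hb k₀]

/-- A map that contracts in a norm equivalent to the sup norm has a fixed point. -/
lemma exists_fixedPoint_of_contraction {N : Seminorm ℝ (K → ℝ)} {C κ : ℝ} (hN : ∀ e, ‖e‖ ≤ N e)
    (hC : ∀ e, N e ≤ C * ‖e‖) (hκ0 : 0 ≤ κ) (hκ : κ < 1) {Φ : (K → ℝ) → K → ℝ}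
    (hΦ : ∀ q q', N (Φ q - Φ q') ≤ κ * N (q - q')) : ∃ q, Φ q = q := by
  have hiter : ∀ n q q', N (Φ^[n] q - Φ^[n] q') ≤ κ ^ n * N (q - q') := fun n => by
    induction n with
    | zero => simp
    | succ n ih =>
      intro q q'
      rw [Function.iterate_succ_apply, Function.iterate_succ_apply]
      refine (ih _ _).trans ?_
      rw [pow_succ, mul_assoc]
      exact mul_le_mul_of_nonneg_left (hΦ q q') (pow_nonneg hκ0 n)
  have hlim : Tendsto (fun n => κ ^ n * C) atTop (𝓝 0) := by
    simpa using (tendsto_pow_atTop_nhds_zero_of_lt_one hκ0 hκ).mul_const C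
  -- An iterate with `κ ^ n * C < 1` contracts in the sup norm, and its fixed point is fixed by `Φ`
  -- as well.
  obtain ⟨n, hn⟩ := (hlim.eventually_lt_const one_pos).exists
  have hcontr : ContractingWith (κ ^ n * C).toNNReal Φ^[n] := by
    refine ⟨by simpa using hn, LipschitzWith.of_dist_le_mul fun q q' => ?_⟩
    rw [dist_eq_norm, dist_eq_norm]
    calc ‖Φ^[n] q - Φ^[n] q'‖ ≤ κ ^ n * N (q - q') := (hN _).trans (hiter n q q')
      _ ≤ κ ^ n * (C * ‖q - q'‖) := mul_le_mul_of_nonneg_left (hC _) (pow_nonneg hκ0 n)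
      _ = κ ^ n * C * ‖q - q'‖ := by ring
      _ ≤ _ := mul_le_mul_of_nonneg_right (Real.le_coe_toNNReal _) (norm_nonneg _)
  exact ⟨_, hcontr.isFixedPt_fixedPoint_iterate⟩

end Spread

/-! ### Contraction of the normalized Bellman operator -/

section Bellman

variable {X A : Type*}

lemma minAction_le_apply [Finite A] (q : X × A → ℝ) (x : X) (a : A) : minAction q x ≤ q (x, a) :=
  ciInf_le (Set.finite_range _).bddBelow a

lemma minAction_le_add [Finite A] [Nonempty A] {q q' : X × A → ℝ} {r : ℝ} (h : ∀ k, q k ≤ q' k + r) (x : X) :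
    minAction q x ≤ minAction q' x + r := by
  rw [← sub_le_iff_le_add]
  refine le_ciInf fun a => ?_
  linarith [minAction_le_apply q x a, h (x, a)]

variable [Fintype X] {M : MDP X A} {R : X → A → (X → ℝ) → ℝ}

lemma bellman_apply (hR : IsRiskMap M R) (q : X × A → ℝ) (k : X × A) :
    bellman M R q k = M.c k.1 k.2 + R k.1 k.2 (minAction q) := by
  unfold bellman
  simp_rw [add_comm (M.c k.1 k.2)]
  exact (hR k.1 k.2).translation _ _

/-- `minAction q` lies between two shifts of `minAction q'`; against each, minorization gains `α`
times the gap at `y`. The two gaps add up to `s`, so the range of differences has length `(1 - α)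
s`. -/
lemma bellman_sub_mem [Finite A] [Nonempty A] (hR : IsRiskMap M R) {y : X} {α : ℝ} (hα : Minorized R y α)
    {q q' : X × A → ℝ} {r s : ℝ} (hlo : ∀ k, q' k + r ≤ q k) (hhi : ∀ k, q k ≤ q' k + (r + s))
    (k : X × A) :
    r + α * (minAction q y - minAction q' y - r) ≤ bellman M R q k - bellman M R q' k ∧
    bellman M R q k - bellman M R q' k ≤
      r + s - α * (r + s - (minAction q y - minAction q' y)) := by
  have h1 : ∀ x, minAction q' x + r ≤ minAction q x := fun x => by
    have := minAction_le_add (q := q') (q' := q) (r := -r) (fun k => by linarith [hlo k]) x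
    linarith
  have h2 : ∀ x, minAction q x ≤ minAction q' x + (r + s) := minAction_le_add hhi
  rw [bellman_apply hR, bellman_apply hR]
  have m1 := hα k.1 k.2 (minAction q) (fun x => minAction q' x + r) h1
  have m2 := hα k.1 k.2 (fun x => minAction q' x + (r + s)) (minAction q) h2
  rw [(hR k.1 k.2).translation] at m1 m2
  constructor <;> linarith

/-- The Bellman operator, normalized by the reference function. -/
noncomputable def relBellman (M : MDP X A) (R : X → A → (X → ℝ) → ℝ) (f : (X × A → ℝ) → ℝ)
    (q : X × A → ℝ) (k : X × A) : ℝ :=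
  bellman M R q k - f q

lemma relBellman_contraction [Fintype A] [Nonempty A] (hR : IsRiskMap M R) {y : X} {α : ℝ} (hα0 : 0 < α)
    (hα1 : α < 1) (hα : Minorized R y α) {f : (X × A → ℝ) → ℝ} (hf : IsReference f) (k₀ : X × A) :
    ∃ (c : ℝ) (hc : 1 ≤ c), ∀ q q',
      spreadNorm k₀ c (zero_le_one.trans hc) (relBellman M R f q - relBellman M R f q') ≤
        (1 - α / 2) * spreadNorm k₀ c (zero_le_one.trans hc) (q - q') := by
  obtain ⟨L, hL0, hL⟩ := hf.lipschitz
  -- The weight `c` solves `(1 + L) + c (1 - α) = (1 - α / 2) c`: half of the gain in oscillation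
  -- pays for the value at `k₀`.
  have hc : 1 ≤ 2 * (1 + L) / α := by
    rw [one_le_div hα0]
    linarith
  refine ⟨2 * (1 + L) / α, hc, fun q q' => ?_⟩
  have hne : Nonempty (X × A) := ⟨k₀⟩
  obtain ⟨kmin, hmin⟩ := Finite.exists_min (q - q')
  set r := (q - q') kmin with hr
  set s := spread (q - q') with hs
  have hs0 : 0 ≤ s := spread_nonneg _
  have hlo : ∀ k, q' k + r ≤ q k := fun k => by
    have := hmin k
    simp only [Pi.sub_apply] at this hr
    linarith
  have hhi : ∀ k, q k ≤ q' k + (r + s) := fun k => by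
    have := sub_le_spread (q - q') k kmin
    simp only [Pi.sub_apply] at this hr
    linarith
  have hmem := bellman_sub_mem hR hα hlo hhi
  set u := minAction q y - minAction q' y
  have hu : r ≤ u ∧ u ≤ r + s := by
    have h1 := minAction_le_add (q := q') (q' := q) (r := -r) (fun k => by linarith [hlo k]) y
    have h2 := minAction_le_add hhi y
    constructor <;> simp only [u] <;> linarith
  have hspread : spread (relBellman M R f q - relBellman M R f q') ≤ (1 - α) * s := by
    refine spread_le (mul_nonneg (by linarith) hs0) fun i j => ?_
    simp only [relBellman, Pi.sub_apply]
    linarith [(hmem i).2, (hmem j).1]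
  -- Translating `q` by `-r` leaves a difference with values in `[0, s]`, so only the oscillation
  -- enters; in `hval` the shift `r` then cancels against the Bellman part.
  have hfq : |f q - f q' - r| ≤ L * s := by
    have h1 : f (fun k => q k + -r) = f q + -r := hf.translation q (-r)
    have h2 := hL (fun k => q k + -r) q'
    have h3 : ‖(fun k => q k + -r) - q'‖ ≤ s := by
      refine (pi_norm_le_iff_of_nonneg hs0).2 fun k => ?_
      rw [Real.norm_eq_abs, abs_le, Pi.sub_apply]
      constructor <;> linarith [hlo k, hhi k]
    rw [h1] at h2
    have h4 : f q - f q' - r = f q + -r - f q' := by ring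
    rw [h4]
    exact h2.trans (mul_le_mul_of_nonneg_left h3 hL0)
  have hval : |(relBellman M R f q - relBellman M R f q') k₀| ≤ (1 + L) * s := by
    have h1 := hmem k₀
    have h2 := mul_nonneg hα0.le (sub_nonneg.2 hu.1)
    have h3 := mul_nonneg hα0.le (sub_nonneg.2 hu.2)
    rw [abs_le] at hfq ⊢
    simp only [relBellman, Pi.sub_apply]
    constructor <;> linarith
  rw [spreadNorm_apply, spreadNorm_apply]
  have h5 := mul_le_mul_of_nonneg_left hspread (zero_le_one.trans hc)
  have h6 : (1 + L) * s + 2 * (1 + L) / α * ((1 - α) * s) =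
      (1 - α / 2) * (2 * (1 + L) / α * s) := by
    field_simp
    ring
  have h7 : 0 ≤ (1 - α / 2) * |(q - q') k₀| := mul_nonneg (by linarith) (abs_nonneg _)
  rw [mul_add (1 - α / 2)]
  linarith

end Bellman

/-! ### Optimality of greedy policies -/

section Optimality

variable {X A : Type*} [Fintype A]

lemma riskUnder_stationary (R : X → A → (X → ℝ) → ℝ) (d : X → A) (n : ℕ) (v : X → ℝ) (x : X) :
    riskUnder R (stationary d n) v x = R x (d x) v := by
  classical
  unfold riskUnder stationary
  rw [Finset.sum_eq_single (d x)]
  · simp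
  · intro a _ ha
    simp [Pi.single_eq_of_ne ha]
  · simp

variable [Fintype X] {M : MDP X A} {R : X → A → (X → ℝ) → ℝ}

lemma costUnder_stationary (M : MDP X A) (d : X → A) (n : ℕ) (x : X) :
    costUnder M (stationary d n) x = M.c x (d x) := by
  classical
  unfold costUnder stationary
  rw [Finset.sum_eq_single (d x)]
  · simp
  · intro a _ ha
    simp [Pi.single_eq_of_ne ha]
  · simp

lemma abs_costUnder_le {B : ℝ} (hB : ∀ x a, |M.c x a| ≤ B) (π : X → stdSimplex ℝ A) (x : X) :
    |costUnder M π x| ≤ B := by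
  have h1 : costUnder M π x ≤ expect (π x) fun _ => B :=
    expect_mono fun a _ => (abs_le.1 (hB x a)).2
  have h2 : expect (π x) (fun _ => -B) ≤ costUnder M π x :=
    expect_mono fun a _ => (abs_le.1 (hB x a)).1
  rw [expect_const] at h1 h2
  exact abs_le.2 ⟨h2, h1⟩

/-- This crude bound keeps the averages bounded above, so that their real `limsup` is not a default
value. -/
lemma totalRisk_le (hR : IsRiskMap M R) {B : ℝ} (hB : ∀ x a, |M.c x a| ≤ B) (T : ℕ)
    (π : ℕ → X → stdSimplex ℝ A) (x : X) : totalRisk M R T π x ≤ (T + 1) * B := by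
  induction T generalizing π x with
  | zero =>
    simpa [totalRisk] using (abs_le.1 (abs_costUnder_le hB (π 0) x)).2
  | succ T ih =>
    have h1 := (abs_le.1 (abs_costUnder_le hB (π 0) x)).2
    have h2 : riskUnder R (π 0) (totalRisk M R T fun t => π (t + 1)) x ≤
        expect (π 0 x) fun _ => (T + 1) * B :=
      expect_mono fun a _ => (hR x a).le_of_le_const (ih _)
    rw [expect_const] at h2
    rw [totalRisk]
    push_cast
    linarith

variable {g : ℝ} {h : X → ℝ}

/-- Each stage of the induction adds one `g`: translation and monotonicity carry the lower bound `h
+ r` through `R`, and the optimality inequality is averaged over actions. The horizon `T` has `T +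
1` costs; the constant settles `T = 0`. -/
lemma le_totalRisk (hR : IsRiskMap M R) {B : ℝ} (hB : ∀ x a, |M.c x a| ≤ B)
    (hgh : ∀ x a, g + h x ≤ M.c x a + R x a h) (T : ℕ) (π : ℕ → X → stdSimplex ℝ A) (x : X) :
    (T + 1) * g + h x - (B + |g| + ‖h‖) ≤ totalRisk M R T π x := by
  induction T generalizing π x with
  | zero =>
    have h1 := (abs_le.1 (abs_costUnder_le hB (π 0) x)).1
    have h2 : |h x| ≤ ‖h‖ := norm_le_pi_norm h x
    rw [totalRisk]
    push_cast
    linarith [le_abs_self g, le_abs_self (h x)]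
  | succ T ih =>
    set w := totalRisk M R T fun t => π (t + 1)
    set r := (T + 1) * g - (B + |g| + ‖h‖) with hr
    have h1 : ∀ a, R x a h + r ≤ R x a w := fun a => by
      have := (hR x a).le_add (v := h) (w := w) (r := -r) fun y => by
        linarith [ih (fun t => π (t + 1)) y]
      linarith
    have h2 : expect (π 0 x) (fun _ => g + h x + r) ≤
        expect (π 0 x) fun a => M.c x a + R x a w :=
      expect_mono fun a _ => by linarith [h1 a, hgh x a]
    rw [expect_const, expect_add] at h2
    change _ ≤ costUnder M (π 0) x + riskUnder R (π 0) w x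
    have h3 : expect (π 0 x) (M.c x) = costUnder M (π 0) x := rfl
    have h4 : expect (π 0 x) (fun a => R x a w) = riskUnder R (π 0) w x := rfl
    push_cast
    linarith

lemma totalRisk_stationary_le (hR : IsRiskMap M R) {B : ℝ} (hB : ∀ x a, |M.c x a| ≤ B) {d : X → A}
    (hgh : ∀ x, M.c x (d x) + R x (d x) h = g + h x) (T : ℕ) (x : X) :
    totalRisk M R T (stationary d) x ≤ (T + 1) * g + h x + (B + |g| + ‖h‖) := by
  induction T generalizing x with
  | zero =>
    have h1 := (abs_le.1 (abs_costUnder_le hB (stationary d 0) x)).2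
    have h2 : |h x| ≤ ‖h‖ := norm_le_pi_norm h x
    rw [totalRisk]
    push_cast
    linarith [neg_abs_le g, neg_abs_le (h x)]
  | succ T ih =>
    have h1 := (hR x (d x)).le_add (v := totalRisk M R T (stationary d)) (w := h)
      (r := (T + 1) * g + (B + |g| + ‖h‖)) fun y => by linarith [ih y]
    change costUnder M (stationary d 0) x +
      riskUnder R (stationary d 0) (totalRisk M R T (stationary d)) x ≤ _
    rw [costUnder_stationary, riskUnder_stationary]
    push_cast
    linarith [hgh x]

lemma tendsto_affine_average (g b : ℝ) :
    Tendsto (fun T : ℕ => 1 / (T : ℝ) * ((T + 1) * g + b)) atTop (𝓝 g) := by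
  have h1 : Tendsto (fun T : ℕ => g + (g + b) * (1 / (T : ℝ))) atTop (𝓝 (g + (g + b) * 0)) :=
    (tendsto_one_div_atTop_nhds_zero_nat.const_mul _).const_add _
  rw [mul_zero, add_zero] at h1
  refine h1.congr' ?_
  filter_upwards [eventually_gt_atTop 0] with T hT
  have : (T : ℝ) ≠ 0 := by positivity
  field_simp
  ring

lemma exists_abs_cost_le (M : MDP X A) : ∃ B, ∀ x a, |M.c x a| ≤ B :=
  ⟨‖fun k : X × A => M.c k.1 k.2‖, fun x a =>
    norm_le_pi_norm (fun k : X × A => M.c k.1 k.2) (x, a)⟩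

lemma averageRisk_stationary_eq (hR : IsRiskMap M R) {d : X → A}
    (hle : ∀ x a, g + h x ≤ M.c x a + R x a h) (hgh : ∀ x, M.c x (d x) + R x (d x) h = g + h x)
    (x : X) : averageRisk M R (stationary d) x = g := by
  obtain ⟨B, hB⟩ := exists_abs_cost_le M
  refine Tendsto.limsup_eq (tendsto_of_tendsto_of_tendsto_of_le_of_le
    (tendsto_affine_average g (h x - (B + |g| + ‖h‖)))
    (tendsto_affine_average g (h x + (B + |g| + ‖h‖))) (fun T => ?_) fun T => ?_)
  · refine mul_le_mul_of_nonneg_left ?_ (by positivity)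
    linarith [le_totalRisk hR hB hle T (stationary d) x]
  · refine mul_le_mul_of_nonneg_left ?_ (by positivity)
    linarith [totalRisk_stationary_le hR hB hgh T x]

lemma le_averageRisk (hR : IsRiskMap M R) (hle : ∀ x a, g + h x ≤ M.c x a + R x a h)
    (π : ℕ → X → stdSimplex ℝ A) (x : X) : g ≤ averageRisk M R π x := by
  obtain ⟨B, hB⟩ := exists_abs_cost_le M
  have hlow := tendsto_affine_average g (h x - (B + |g| + ‖h‖))
  have hup := tendsto_affine_average B 0
  unfold averageRisk
  rw [← hlow.limsup_eq]
  refine limsup_le_limsup (Eventually.of_forall fun T => ?_) hlow.isCoboundedUnder_le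
    (hup.isBoundedUnder_le.mono_le (Eventually.of_forall fun T => ?_))
  · refine mul_le_mul_of_nonneg_left ?_ (by positivity)
    linarith [le_totalRisk hR hB hle T π x]
  · refine mul_le_mul_of_nonneg_left ?_ (by positivity)
    linarith [totalRisk_le hR hB T π x]

end Optimality

/-! ### Convergence of Q-learning -/

section QLearning

variable {X A : Type*}

lemma IsGreedy.minAction_eq [Finite A] [Nonempty A] {q : X × A → ℝ} {d : X → A} (hd : IsGreedy q d) (x : X) :
    minAction q x = q (x, d x) :=
  le_antisymm (minAction_le_apply q x (d x)) (le_ciInf fun a => hd x a)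

variable [Fintype X] {M : MDP X A} {R : X → A → (X → ℝ) → ℝ} {f : (X × A → ℝ) → ℝ}
  {Qs : X × A → ℝ}

lemma cost_add_risk_eq (hR : IsRiskMap M R) (hQs : relBellman M R f Qs = Qs) (x : X) (a : A) :
    M.c x a + R x a (minAction Qs) = f Qs + Qs (x, a) := by
  have h1 := congrFun hQs (x, a)
  rw [relBellman, bellman_apply hR] at h1
  dsimp only at h1
  linarith

variable [Fintype A]

lemma solvesAROE_of_fixedPoint [Nonempty A] (hR : IsRiskMap M R) (hQs : relBellman M R f Qs = Qs) :
    SolvesAROE M R (f Qs) (minAction Qs) := fun x => by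
  simp_rw [cost_add_risk_eq hR hQs]
  exact add_ciInf (Set.finite_range _).bddBelow _

lemma averageRisk_of_isGreedy [Nonempty A] (hR : IsRiskMap M R) (hQs : relBellman M R f Qs = Qs)
    {d : X → A} (hd : IsGreedy Qs d) :
    IsOptimal M R d ∧ ∀ x₀, averageRisk M R (stationary d) x₀ = f Qs := by
  have hle : ∀ x a, f Qs + minAction Qs x ≤ M.c x a + R x a (minAction Qs) := fun x a => by
    rw [cost_add_risk_eq hR hQs]
    linarith [minAction_le_apply Qs x a]
  have heq : ∀ x, averageRisk M R (stationary d) x = f Qs :=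
    averageRisk_stationary_eq hR hle fun x => by
      rw [cost_add_risk_eq hR hQs, hd.minAction_eq]
  exact ⟨fun x π => (heq x).trans_le (le_averageRisk hR hle π x), heq⟩

/-- An action that is not minimal for `Qs` is strictly beaten, and the finitely many strict
inequalities eventually hold for `u n`. -/
lemma eventually_isGreedy {u : ℕ → X × A → ℝ} (hu : Tendsto u atTop (𝓝 Qs)) :
    ∀ᶠ n in atTop, ∀ d : X → A, IsGreedy (u n) d → IsGreedy Qs d := by
  have h1 : ∀ x a a', ∀ᶠ n in atTop, Qs (x, a) < Qs (x, a') → u n (x, a) < u n (x, a') :=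
    fun x a a' => by
      by_cases hlt : Qs (x, a) < Qs (x, a')
      · filter_upwards [(tendsto_pi_nhds.1 hu (x, a)).eventually_lt
          (tendsto_pi_nhds.1 hu (x, a')) hlt] with n hn _ using hn
      · exact Eventually.of_forall fun n h => absurd h hlt
  have h2 := eventually_all.2 fun x => eventually_all.2 fun a => eventually_all.2 (h1 x a)
  filter_upwards [h2] with n hn d hd x a
  by_contra hlt
  exact absurd (hd x a) (not_le.2 (hn x a (d x) (not_le.1 hlt)))

lemma IsReference.measurable (hf : IsReference f) : Measurable f := by
  obtain ⟨L, -, hL⟩ := hf.lipschitz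
  have : LipschitzWith L.toNNReal f := LipschitzWith.of_dist_le_mul fun p q => by
    rw [Real.dist_eq, dist_eq_norm]
    exact (hL p q).trans (mul_le_mul_of_nonneg_right (Real.le_coe_toNNReal L) (norm_nonneg _))
  exact this.continuous.measurable

/-- Convergence of the Q-learning iterates to a fixed point of the normalized Bellman operator,
which contracts in the norm `N`. -/
theorem tendsto_qIter (hf : IsReference f) {N : Seminorm ℝ (X × A → ℝ)} {C κ : ℝ}
    (hN : ∀ e, ‖e‖ ≤ N e) (hC : ∀ e, N e ≤ C * ‖e‖) (hκ0 : 0 ≤ κ) (hκ : κ < 1)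
    (hΦ : ∀ q q', N (relBellman M R f q - relBellman M R f q') ≤ κ * N (q - q'))
    (hQs : relBellman M R f Qs = Qs) {E : Type*} [MeasurableSpace E] {η : Measure E}
    {Hhat : (X × A → ℝ) → E → X × A → ℝ} {γ : ℕ → ℝ} (Q₀ : X × A → ℝ) {Ω : Type*}
    [MeasurableSpace Ω] {μ : Measure Ω} [IsProbabilityMeasure μ] {ξ : ℕ → Ω → E}
    (hH : IsUnbiasedEstimator η (bellman M R) Hhat) (hγ : RobbinsMonro γ)
    (hξ : ∀ n, Measurable (ξ n)) (hlaw : ∀ n, μ.map (ξ n) = η) (hind : iIndepFun ξ μ) :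
    ∀ᵐ ω ∂μ, Tendsto (fun n => qIter f Hhat γ Q₀ (fun i => ξ i ω) n) atTop (𝓝 Qs) := by
  have hη : IsProbabilityMeasure η := by
    rw [← hlaw 0]; exact Measure.isProbabilityMeasure_map (hξ 0).aemeasurable
  obtain ⟨D, hD, hvar⟩ := hH.var
  -- For frozen `q`, subtracting the constant `f q` centers the estimator at the normalized operator
  -- without changing its variance.
  refine stochasticApproximation hN hC hκ0 hκ (Φ := relBellman M R f)
    (Y := fun q y k => Hhat q y k - f q) (fun q => ?_) ?_ (fun q k => ?_) (fun q k => ?_) hD.le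
    (fun q k => ?_) hγ hξ hlaw hind (Q := fun n ω => qIter f Hhat γ Q₀ (fun i => ξ i ω) n)
    (q₀ := Q₀) (fun ω => rfl) fun n ω => ?_
  · simpa only [hQs] using hΦ q Qs
  · have h1 : Measurable fun z : (X × A → ℝ) × E => Hhat z.1 z.2 := hH.measurable
    have h2 := hf.measurable
    refine measurable_pi_lambda _ fun k => ?_
    exact ((measurable_pi_apply k).comp h1).sub (h2.comp measurable_fst)
  · exact (hH.memLp q k).sub (memLp_const (f q))
  · rw [integral_sub ((hH.memLp q k).integrable one_le_two) (integrable_const _), hH.mean]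
    simp [relBellman]
  · rw [variance_sub_const (hH.memLp q k).aestronglyMeasurable]
    exact hvar q k
  · rfl

end QLearning

/-- The properties of a risk map behind the convergence of Q-learning. -/
lemma exists_riskMap_properties {X A : Type*} [Fintype X] (M : MDP X A)
    (R : X → A → (X → ℝ) → ℝ)
    (hR :
      (∃ l : ℝ → ℝ, IsUBSRLoss l ∧ BoundedSlope l ∧ ∀ x a, R x a = UBSR l (M.P x a)) ∨
      (∃ l : ℝ → ℝ, IsOCELoss l ∧ BoundedSlope l ∧ ∀ x a, R x a = OCE l (M.P x a)) ∨
      (∃ (φ : ℝ → ℝ) (ε L : ℝ), IsSpectrum φ ∧ 0 < ε ∧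
        (∀ β ∈ Set.Icc (0 : ℝ) 1, ε ≤ φ β ∧ φ β ≤ L) ∧
        ∀ x a, R x a = spectralRisk φ (M.P x a))) :
    IsRiskMap M R ∧ WassersteinLipschitz M R ∧
      (∀ x a v, ∃ l, Tendsto (fun s : ℝ => 1 / s * R x a (s • v)) atTop (𝓝 l)) ∧
      ∃ δ L : ℝ, 0 < δ ∧ ∀ x a, HasSlopes (M.P x a) (R x a) δ L := by
  rcases hR with ⟨l, hl, hb, h⟩ | ⟨l, hl, hb, h⟩ | ⟨φ, ε, L, hφ, hε, hb, h⟩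
  · obtain ⟨ε, L, hε, hL, hs⟩ := hb.exists_slopesIn
    have hmon : IsRiskMap M R := fun x a => by
      rw [h]; exact isMonetary_UBSR hε hs hl.continuous hl.monotone hl.zero _
    refine ⟨hmon, ⟨L / ε, by positivity, fun v w x a => ?_⟩, fun x a v => ?_, ε / L, L / ε,
      by positivity, fun x a => ?_⟩
    · rw [h]
      -- By law invariance the two risks are computed on the coupling space, where the slope bound
      -- applies to the two coordinates.
      refine ofReal_le_wasserstein (by positivity) fun S q hv hw => ?_
      rw [← UBSR_eq_of_lawOf_eq l hv, ← UBSR_eq_of_lawOf_eq l hw]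
      exact (hasSlopes_UBSR hε hL hs hl.continuous hl.monotone hl.zero q).abs_sub_le
        (by positivity) (by positivity) _ _
    · refine (hmon x a).exists_tendsto_of_convex ?_ v
      rw [h]
      exact UBSR_convex hε hs hl.continuous hl.convex hl.zero _
    · rw [h]; exact hasSlopes_UBSR hε hL hs hl.continuous hl.monotone hl.zero _
  · obtain ⟨ε, L, hε, hL, hs⟩ := hb.exists_slopesIn
    have hmon : IsRiskMap M R := fun x a => by
      rw [h]; exact isMonetary_OCE hl _
    refine ⟨hmon, ⟨L, hL, fun v w x a => ?_⟩, fun x a v => ?_, ε, L, hε, fun x a => ?_⟩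
    · rw [h]
      refine ofReal_le_wasserstein hL fun S q hv hw => ?_
      rw [← OCE_eq_of_lawOf_eq l hv, ← OCE_eq_of_lawOf_eq l hw]
      exact (hasSlopes_OCE hs hl q).abs_sub_le hε.le hL.le _ _
    · refine (hmon x a).exists_tendsto_of_convex ?_ v
      rw [h]
      exact OCE_convex hl _
    · rw [h]; exact hasSlopes_OCE hs hl _
  · have hL : 0 < L := by
      have := hb 0 (by simp)
      linarith
    have hmon : IsRiskMap M R := fun x a => by
      rw [h]; exact isMonetary_spectralRisk hφ _
    refine ⟨hmon, ⟨L, hL, fun v w x a => ?_⟩, fun x a v => ⟨R x a v, ?_⟩, ε, L, hε, fun x a => ?_⟩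
    · rw [h]
      refine ofReal_le_wasserstein hL fun S q hv hw => ?_
      rw [← spectralRisk_eq_of_lawOf_eq φ hv, ← spectralRisk_eq_of_lawOf_eq φ hw]
      exact (hasSlopes_spectralRisk hφ hb q).abs_sub_le hε.le hL.le _ _
    · refine tendsto_const_nhds.congr' ?_
      filter_upwards [eventually_gt_atTop 0] with s hs
      rw [h, spectralRisk_smul φ _ hs]
      field_simp
    · rw [h]; exact hasSlopes_spectralRisk hφ hb _

end RiskMDP

open RiskMDP in
theorem mainTheorem5 {X A : Type*} [Fintype X] [Fintype A] [Nonempty X] [Nonempty A]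
    (M : MDP X A) (hM : M.StronglyErgodic) (R : X → A → (X → ℝ) → ℝ)
    (hR :
      (∃ l : ℝ → ℝ, IsUBSRLoss l ∧ BoundedSlope l ∧ ∀ x a, R x a = UBSR l (M.P x a)) ∨
      (∃ l : ℝ → ℝ, IsOCELoss l ∧ BoundedSlope l ∧ ∀ x a, R x a = OCE l (M.P x a)) ∨
      (∃ (φ : ℝ → ℝ) (ε L : ℝ), IsSpectrum φ ∧ 0 < ε ∧
        (∀ β ∈ Set.Icc (0 : ℝ) 1, ε ≤ φ β ∧ φ β ≤ L) ∧
        ∀ x a, R x a = spectralRisk φ (M.P x a))) :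
    IsRiskMap M R ∧ Doeblin R ∧ AsymptoticallyCoherent M R ∧ WassersteinLipschitz M R ∧
    -- the Q-learning convergence theorem holds for `R`
    ∀ f : (X × A → ℝ) → ℝ, IsReference f →
      ∃ Qs : X × A → ℝ,
        SolvesAROE M R (f Qs) (minAction Qs) ∧
        (∀ d : X → A, IsGreedy Qs d →
          IsOptimal M R d ∧ ∀ x₀, averageRisk M R (stationary d) x₀ = f Qs) ∧
        ∀ (E : Type*) [MeasurableSpace E] (η : Measure E)
          (Hhat : (X × A → ℝ) → E → X × A → ℝ) (γ : ℕ → ℝ) (Q₀ : X × A → ℝ)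
          (Ω : Type*) [MeasurableSpace Ω] (μ : Measure Ω) [IsProbabilityMeasure μ]
          (ξ : ℕ → Ω → E),
          IsUnbiasedEstimator η (bellman M R) Hhat → RobbinsMonro γ →
          (∀ n, Measurable (ξ n)) → (∀ n, μ.map (ξ n) = η) → iIndepFun ξ μ →
          ∀ᵐ ω ∂μ,
            Tendsto (fun n => qIter f Hhat γ Q₀ (fun i => ξ i ω) n) atTop (𝓝 Qs) ∧
            ∀ᶠ n in atTop, ∀ d : X → A,
              IsGreedy (qIter f Hhat γ Q₀ (fun i => ξ i ω) n) d → IsGreedy Qs d := by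
  obtain ⟨hmon, hW, hlim, δ, L, hδ, hs⟩ := exists_riskMap_properties M R hR
  obtain ⟨y, hy⟩ := hM.2
  obtain ⟨α, hα0, hα1, hα⟩ := exists_minorized hy hδ hs
  refine ⟨hmon, doeblin_of_minorized hα0 hα1 hα, asymptoticallyCoherent_of_tendsto hmon hlim, hW,
    fun f hf => ?_⟩
  obtain ⟨c, hc, hΦ⟩ := relBellman_contraction hmon hα0 hα1 hα hf (Classical.arbitrary (X × A))
  have hN := norm_le_spreadNorm (Classical.arbitrary (X × A)) hc
  have hC := spreadNorm_le (Classical.arbitrary (X × A)) (zero_le_one.trans hc)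
  have hκ0 : 0 ≤ 1 - α / 2 := by linarith
  have hκ : 1 - α / 2 < 1 := by linarith
  obtain ⟨Qs, hQs⟩ := exists_fixedPoint_of_contraction hN hC hκ0 hκ hΦ
  refine ⟨Qs, solvesAROE_of_fixedPoint hmon hQs, fun d hd => averageRisk_of_isGreedy hmon hQs hd,
    fun E _ η Hhat γ Q₀ Ω _ μ _ ξ hH hγ hξ hlaw hind => ?_⟩
  filter_upwards [tendsto_qIter hf hN hC hκ0 hκ hΦ hQs Q₀ hH hγ hξ hlaw hind] with ω hω
  exact ⟨hω, eventually_isGreedy hω⟩
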